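/- Here $H^1=H^1(\mathbb R;\mathbb K)$ ($\mathbb K=\mathbb R$ or $\mathbb C$) is the space of $f\in L^2(\mathbb R;\mathbb K)$ with weak derivative $\partial_z f\in L^2$, with norm $\|f\|_{H^1}^2=\|f\|_{L^2}^2+\|\partial_z f\|_{L^2}^2$; vector-valued functions carry $\|u\|_{H^1}^2=\sum_j\|u_j\|_{H^1}^2$. **AMLE.** For real parameters $\omega_0,n,\varepsilon,\nu,k_B$ and $g:\mathbb R\times\mathbb R\to\mathbb R$, the anharmonic Maxwell--Lorentz equations for real-valued $u=(E,B,P,Q)$ are $$\partial_tE=\partial_zB-Q,\qquad \partial_tB=\partial_zE,\qquad \partial_tP=Q,$$ $$\partial_tQ=-\omega_0^2\bigl(1-2\varepsilon\nu\cos(2k_Bz)\bigr)P-\omega_0^2\,g(P,z)+\omega_0^2(n^2-1)E .$$ Hypothesis N1 on $g$: the partial derivatives $\partial_Pg$, $\partial_zg$ exist everywhere, and there is a constant $C_g$ such that for all $P,z\in\mathbb R$ $$|g(P,z)|+|\partial_zg(P,z)|\le C_g|P|,\qquad |\partial_Pg(P,z)|\le C_g .$$ **NLCME.** For real parameters $v_g,\kappa,\Gamma$,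 the nonlinear coupled mode equations for complex-valued $u=(E_+,E_-)$, with time variable written $t$ and space variable $z$, are $$i(\partial_tE_++v_g\,\partial_zE_+)+\kappa E_-+\Gamma\bigl(|E_+|^2+2|E_-|^2\bigr)E_+=0,$$ $$i(\partial_tE_--v_g\,\partial_zE_-)+\kappa E_++\Gamma\bigl(|E_-|^2+2|E_+|^2\bigr)E_-=0 .$$ For $T\in[0,\infty]$, an $H^1$ solution on $[0,T)$ with initial value $u_0\in H^1$ is a continuous map $u:[0,T)\to H^1$ with $u(0)=u_0$ that is differentiable in time as a map into $L^2$ (from the right at $t=0$) and satisfies the system in $L^2$ at every $t\in[0,T)$. The maximal existence time $T_{\max}(u_0)\in[0,\infty]$ is the supremum of all $T$ for which such a solution exists. **Theorem.** (a) Suppose $g$ satisfies Hypothesis N1. There is a constant $C>0$, depending only on the parameters and on $g$, such that for every $u_0\in H^1(\mathbb R;\mathbb R^4)$: $T_{\max}(u_0)=\infty$ for AMLE; AMLE has an $H^1$ solution $u$ on $[0,\infty)$ with initial value $u_0$; every $H^1$ solution on an interval $[0,T)$ with the same initial value coincides with $u$ on $[0,T)$; and $$\|u(t)\|_{H^1}\le\|u_0\|_{H^1}\,e^{Ct}\qquad(t\ge0).$$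 (b) For every $R$ there is a constant $c>0$, depending only on $R$ and on $v_g,\kappa,\Gamma$, such that for every $u_0\in H^1(\mathbb R;\mathbb C^2)$ with $\|u_0\|_{H^1}\le R$: $T_{\max}(u_0)=\infty$ for NLCME; NLCME has an $H^1$ solution $u$ on $[0,\infty)$ with initial value $u_0$; every $H^1$ solution on an interval $[0,T)$ with the same initial value coincides with $u$ on $[0,T)$; and $$\|u(t)\|_{H^1}\le\|u_0\|_{H^1}\,e^{c(e^{ct}-1)}\qquad(t\ge0).$$ -/

import Mathlib

open MeasureTheory Set
open scoped ContDiff ENNReal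

noncomputable section

namespace GapSoliton

/-- Square integrable functions on the real line with values in `F` (with Lebesgue measure). -/
abbrev L2 (F : Type*) [NormedAddCommGroup F] : Type _ := Lp F 2 (volume : Measure ℝ)

/-- `f'` is the weak derivative of `f`: `∫ φ' f = - ∫ φ f'` for every real test function `φ`. -/
def HasWeakDeriv {F : Type*} [NormedAddCommGroup F] [NormedSpace ℝ F] (f f' : L2 F) : Prop :=
  ∀ φ : ℝ → ℝ, ContDiff ℝ ∞ φ → HasCompactSupport φ →
    (∫ z, deriv φ z • f z) = -(∫ z, φ z • f' z)

theorem integrable_testFunction_smul {F : Type*} [NormedAddCommGroup F] [NormedSpace ℝ F]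
    {φ : ℝ → ℝ} (hφ : Continuous φ) (hs : HasCompactSupport φ) (f : L2 F) :
    Integrable (fun z => φ z • f z) :=
  memLp_one_iff_integrable.1
    ((Lp.memLp f).smul (r := 1) (hφ.memLp_of_hasCompactSupport (p := 2) hs))

/-- The Sobolev space `H¹(ℝ; F)`, realized as the space of pairs (function, weak derivative)
inside `L² × L²`. Its norm is `‖f‖_{H¹} = (‖f‖² + ‖∂_z f‖²)^{1/2}` with `L²` norms. -/
def H1 (F : Type*) [NormedAddCommGroup F] [NormedSpace ℝ F] :
    Submodule ℝ (WithLp 2 (L2 F × L2 F)) where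
  carrier := {p | HasWeakDeriv p.fst p.snd}
  zero_mem' := by
    intro φ _ _
    simp
  add_mem' := by
    intro p q hp hq φ hφ hs
    have hφ' : Continuous (deriv φ) := hφ.continuous_deriv (by simp)
    have key : ∀ ψ : ℝ → ℝ, Continuous ψ → HasCompactSupport ψ → ∀ f g : L2 F,
        (∫ z, ψ z • (f + g : L2 F) z) = (∫ z, ψ z • f z) + (∫ z, ψ z • g z) := by
      intro ψ hψ hc f g
      rw [← integral_add (integrable_testFunction_smul hψ hc f)
        (integrable_testFunction_smul hψ hc g)]
      refine integral_congr_ae ?_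
      filter_upwards [Lp.coeFn_add f g] with z hz
      rw [hz, Pi.add_apply, smul_add]
    have h1 := key _ hφ' hs.deriv p.fst q.fst
    have h2 := key _ hφ.continuous hs p.snd q.snd
    simp only [WithLp.add_fst, WithLp.add_snd]
    rw [h1, h2, hp φ hφ hs, hq φ hφ hs, neg_add]
  smul_mem' := by
    intro c p hp φ hφ hs
    have key : ∀ ψ : ℝ → ℝ, ∀ f : L2 F,
        (∫ z, ψ z • (c • f : L2 F) z) = c • (∫ z, ψ z • f z) := by
      intro ψ f
      rw [← integral_smul]
      refine integral_congr_ae ?_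
      filter_upwards [Lp.coeFn_smul c f] with z hz
      simp [hz, smul_comm c]
    simp only [WithLp.smul_fst, WithLp.smul_snd]
    rw [key, key, hp φ hφ hs, smul_neg]

variable {F : Type*} [NormedAddCommGroup F] [NormedSpace ℝ F]

/-- The underlying square integrable function of an element of `H¹`. -/
def toL2 (f : H1 F) : L2 F := (f : WithLp 2 (L2 F × L2 F)).fst

/-- The spatial (weak) derivative `∂_z f` of an element of `H¹`. -/
def dz (f : H1 F) : L2 F := (f : WithLp 2 (L2 F × L2 F)).snd

/-- The time interval `[0, T)`, where `T = ⊤` is allowed. -/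
def timeInterval (T : EReal) : Set ℝ := {t | 0 ≤ t ∧ (t : EReal) < T}

/-- The curve `s ↦ f s` in `H¹` is differentiable at time `t` as a curve in `L²`
(from the right at `t = 0`), and its time derivative is the element `D` of `L²`. -/
def HasTimeDeriv (T : EReal) (f : ℝ → H1 F) (D : L2 F) (t : ℝ) : Prop :=
  HasDerivWithinAt (fun s => toL2 (f s)) D (timeInterval T) t

/-- States `u = (E, B, P, Q)` of the anharmonic Maxwell-Lorentz system in `H¹(ℝ; ℝ⁴)`,
with norm `(∑ⱼ ‖uⱼ‖_{H¹}²)^{1/2}`. -/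
abbrev AMLEState : Type := PiLp 2 (fun _ : Fin 4 => H1 ℝ)

/-- States `(E₊, E₋)` of the nonlinear coupled mode equations in `H¹(ℝ; ℂ²)`,
with norm `(‖E₊‖_{H¹}² + ‖E₋‖_{H¹}²)^{1/2}`. -/
abbrev NLCMEState : Type := PiLp 2 (fun _ : Fin 2 => H1 ℂ)

/-- The hypothesis on the nonlinearity `g = g(P, z)`: both partial derivatives exist and
`|g(P,z)| + |∂_z g(P,z)| ≤ C |P|`, `|∂_P g(P,z)| ≤ C` for all `P` and `z`. -/
def HypothesisN1 (g : ℝ → ℝ → ℝ) : Prop :=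
  ∃ C : ℝ, ∀ P z : ℝ,
    DifferentiableAt ℝ (fun p => g p z) P ∧ DifferentiableAt ℝ (fun y => g P y) z ∧
    |g P z| + |deriv (fun y => g P y) z| ≤ C * |P| ∧ |deriv (fun p => g p z) P| ≤ C

/-- `u = (E, B, P, Q)` is an `H¹` solution on `[0, T)`, with initial value `u₀`, of the
anharmonic Maxwell-Lorentz equations
`∂_t E = ∂_z B - Q`, `∂_t B = ∂_z E`, `∂_t P = Q`,
`∂_t Q = -ω₀² (1 - 2 ε ν cos(2 k_B z)) P - ω₀² g(P, z) + ω₀² (n² - 1) E`: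
it is continuous in time with values in `H¹`, and the equations hold in `L²`. -/
structure IsAMLESolution (ω₀ n ε ν k_B : ℝ) (g : ℝ → ℝ → ℝ) (T : EReal)
    (u₀ : AMLEState) (u : ℝ → AMLEState) : Prop where
  continuousOn : ContinuousOn u (timeInterval T)
  initial : u 0 = u₀
  eq_E : ∀ t ∈ timeInterval T,
    HasTimeDeriv T (fun s => u s 0) (dz (u t 1) - toL2 (u t 3)) t
  eq_B : ∀ t ∈ timeInterval T, HasTimeDeriv T (fun s => u s 1) (dz (u t 0)) t
  eq_P : ∀ t ∈ timeInterval T, HasTimeDeriv T (fun s => u s 2) (toL2 (u t 3)) t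
  eq_Q : ∀ t ∈ timeInterval T, ∃ D : L2 ℝ, HasTimeDeriv T (fun s => u s 3) D t ∧
    ∀ᵐ z : ℝ, D z =
      -ω₀ ^ 2 * (1 - 2 * ε * ν * Real.cos (2 * k_B * z)) * toL2 (u t 2) z
        - ω₀ ^ 2 * g (toL2 (u t 2) z) z + ω₀ ^ 2 * (n ^ 2 - 1) * toL2 (u t 0) z

/-- `(E₊, E₋)` is an `H¹` solution on `[0, T)`, with initial value `u₀`, of the nonlinear
coupled mode equations
`i (∂_T E₊ + v_g ∂_Z E₊) + κ E₋ + Γ (|E₊|² + 2 |E₋|²) E₊ = 0`,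
`i (∂_T E₋ - v_g ∂_Z E₋) + κ E₊ + Γ (|E₋|² + 2 |E₊|²) E₋ = 0`:
it is continuous in time with values in `H¹`, and the equations hold in `L²`. -/
structure IsNLCMESolution (v_g κ Γ : ℝ) (T : EReal)
    (u₀ : NLCMEState) (u : ℝ → NLCMEState) : Prop where
  continuousOn : ContinuousOn u (timeInterval T)
  initial : u 0 = u₀
  eq_plus : ∀ t ∈ timeInterval T, ∃ D : L2 ℂ, HasTimeDeriv T (fun s => u s 0) D t ∧
    ∀ᵐ z : ℝ, Complex.I * (D z + v_g * dz (u t 0) z) + κ * toL2 (u t 1) z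
      + Γ * ((‖toL2 (u t 0) z‖ ^ 2 + 2 * ‖toL2 (u t 1) z‖ ^ 2 : ℝ) : ℂ) * toL2 (u t 0) z = 0
  eq_minus : ∀ t ∈ timeInterval T, ∃ D : L2 ℂ, HasTimeDeriv T (fun s => u s 1) D t ∧
    ∀ᵐ z : ℝ, Complex.I * (D z - v_g * dz (u t 1) z) + κ * toL2 (u t 0) z
      + Γ * ((‖toL2 (u t 1) z‖ ^ 2 + 2 * ‖toL2 (u t 0) z‖ ^ 2 : ℝ) : ℂ) * toL2 (u t 1) z = 0

/-- The maximal existence time `T_max ∈ [0, ∞]` of `H¹` solutions of AMLE with data `u₀`. -/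
def amleTmax (ω₀ n ε ν k_B : ℝ) (g : ℝ → ℝ → ℝ) (u₀ : AMLEState) : EReal :=
  sSup {T : EReal | 0 ≤ T ∧ ∃ u : ℝ → AMLEState, IsAMLESolution ω₀ n ε ν k_B g T u₀ u}

/-- The maximal existence time `T_max ∈ [0, ∞]` of `H¹` solutions of NLCME with data `u₀`. -/
def nlcmeTmax (v_g κ Γ : ℝ) (u₀ : NLCMEState) : EReal :=
  sSup {T : EReal | 0 ≤ T ∧ ∃ u : ℝ → NLCMEState, IsNLCMESolution v_g κ Γ T u₀ u}

end GapSoliton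

end

/-! Both systems have the form ∂_t u = A ∂_z u + N(u), where A ∂_z generates a group S(t) of L²
isometries: translations of the characteristic components. In the moving frame y(t) = S(-t)u(t) the
space derivative disappears and y' = S(-t)N(S(t)y). If N is globally Lipschitz on L², this is an ODE
in a Banach space: Picard iteration in an exponentially weighted norm solves it globally
(`exists_global_ode`), and Gronwall gives uniqueness.

H¹ regularity is read off from difference quotients. The map y ↦ (y, (y(·+h) - y)/h) is linear and
bounded, and `IsTameNonlinearity` asks that N increase its norm by at most a factor k, uniformly in
h. Gronwall bounds the quotients by ‖u₀‖e^{kt}, with the H¹ norm of u₀; a weak limit as h → 0 is the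
weak derivative and inherits the bound without loss
(`exists_hasWeakDerivs_of_norm_withQuotient_le`).

For AMLE, Hypothesis N1 makes N tame and part (a) follows. For NLCME the cubic term is not
Lipschitz, so its real coefficient |x|² + 2|y|² is cut off at l². The truncated term still only
rotates phases, so the sup norm can grow through κ alone: `IsH1Solution.ae_norm_le_exp` gives the
rate |κ| + 1 whatever l is. Since H¹ embeds in L^∞ (`HasWeakDeriv.ae_norm_le`), on [0, b) a level l
of order e^{(|κ|+1)b} keeps the cutoff inactive. The H¹ growth rate is affine in l², so at time t
the exponent is of order t e^{2(|κ|+1)t}: this is the double exponential. Solutions on bounded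
intervals are glued by uniqueness, itself proved by a cutoff above the sup norms of the two
competitors. -/

noncomputable section

namespace GapSoliton

open Filter Topology BoundedContinuousFunction
open scoped NNReal

set_option linter.unusedSectionVars false

/-! ### Lipschitz ODEs in Banach spaces: global existence and invariant sets. -/

section ODE

variable {X : Type*} [NormedAddCommGroup X] [NormedSpace ℝ X]

theorem norm_integral_le_of_norm_le_exp {f : ℝ → X} {M l t : ℝ} (hl : 0 < l) (ht : 0 ≤ t)
    (hM : 0 ≤ M) (h : ∀ s, 0 ≤ s → ‖f s‖ ≤ M * Real.exp (l * s)) :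
    ‖∫ s in (0 : ℝ)..t, f s‖ ≤ M / l * Real.exp (l * t) := by
  have h1 : ‖∫ s in (0 : ℝ)..t, f s‖ ≤ ∫ s in (0 : ℝ)..t, M * Real.exp (l * s) := by
    refine intervalIntegral.norm_integral_le_of_norm_le ht ?_ ?_
    · exact Eventually.of_forall fun s hs => h s hs.1.le
    · exact Continuous.intervalIntegrable (by fun_prop) _ _
  refine h1.trans ?_
  have h2 : ∫ s in (0 : ℝ)..t, M * Real.exp (l * s)
      = M / l * Real.exp (l * t) - M / l * Real.exp (l * 0) := by
    refine intervalIntegral.integral_eq_sub_of_hasDerivAt (f := fun s => M / l * Real.exp (l * s))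
      (fun s _ => ?_) (Continuous.intervalIntegrable (by fun_prop) _ _)
    have := (((hasDerivAt_id s).const_mul l).exp).const_mul (M / l)
    convert! this using 1
    simp only [id, mul_one]
    field_simp
  rw [h2]
  have : 0 ≤ M / l * Real.exp (l * 0) := by positivity
  linarith

theorem continuous_of_lipschitzWith_of_continuous {F : ℝ → X → X} {K : ℝ≥0}
    (hLip : ∀ t, LipschitzWith K (F t)) (hcont : ∀ x, Continuous fun t => F t x) :
    Continuous fun p : ℝ × X => F p.1 p.2 :=
  continuous_prod_of_continuous_lipschitzWith' (fun p : ℝ × X => F p.1 p.2) K hLip hcont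

/-- Global existence for an ordinary differential equation with a globally Lipschitz right-hand
side that vanishes at the origin. -/
theorem exists_global_ode [CompleteSpace X] {F : ℝ → X → X} {K : ℝ≥0}
    (hLip : ∀ t, LipschitzWith K (F t)) (hcont : ∀ x, Continuous fun t => F t x)
    (h0 : ∀ t, F t 0 = 0) (x₀ : X) :
    ∃ y : ℝ → X, y 0 = x₀ ∧ Continuous y ∧ ∀ t, 0 ≤ t → HasDerivAt y (F t (y t)) t := by
  have hF := continuous_of_lipschitzWith_of_continuous hLip hcont
  -- The unknown is written e^{ls}w(s) with w bounded. Against this weight integration costs a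
  -- factor 1/l, so l = K + 1 gives the Picard map the contraction constant K/(K+1).
  set l : ℝ := K + 1 with hl_def
  have hl : 0 < l := by positivity
  have hc : ∀ w : ℝ →ᵇ X, Continuous fun s => F s (Real.exp (l * s) • w s) := fun w =>
    hF.comp (continuous_id.prodMk
      ((by fun_prop : Continuous fun s => Real.exp (l * s)).smul w.continuous))
  let P : (ℝ →ᵇ X) → ℝ → X := fun w t => x₀ + ∫ s in (0 : ℝ)..t, F s (Real.exp (l * s) • w s)
  have hP : ∀ w t, HasDerivAt (P w) (F t (Real.exp (l * t) • w t)) t := fun w t =>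
    (intervalIntegral.integral_hasDerivAt_right ((hc w).intervalIntegrable _ _)
      (hc w).stronglyMeasurable.stronglyMeasurableAtFilter (hc w).continuousAt).const_add x₀
  have hPc : ∀ w, Continuous (P w) := fun w =>
    continuous_iff_continuousAt.2 fun t => (hP w t).continuousAt
  have hFn : ∀ t x, ‖F t x‖ ≤ K * ‖x‖ := fun t x => by
    have := (hLip t).dist_le_mul x 0
    simpa [h0, dist_eq_norm] using this
  have hexp : ∀ t : ℝ, Real.exp (-(l * t)) * Real.exp (l * t) = 1 := fun t => by
    rw [← Real.exp_add]; simp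
  have hb : ∀ w : ℝ →ᵇ X, ∀ t, ‖Real.exp (-(l * |t|)) • P w |t|‖ ≤ ‖x₀‖ + K * ‖w‖ / l := by
    intro w t
    rw [norm_smul, Real.norm_eq_abs, Real.abs_exp]
    have h1 : ‖P w |t|‖ ≤ ‖x₀‖ + K * ‖w‖ / l * Real.exp (l * |t|) := by
      refine (norm_add_le _ _).trans (add_le_add_right ?_ _)
      refine norm_integral_le_of_norm_le_exp hl (abs_nonneg t) (by positivity) fun s _ => ?_
      refine (hFn _ _).trans ?_
      rw [norm_smul, Real.norm_eq_abs, Real.abs_exp]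
      have := w.norm_coe_le_norm s
      calc (K : ℝ) * (Real.exp (l * s) * ‖w s‖) ≤ K * (Real.exp (l * s) * ‖w‖) := by gcongr
        _ = _ := by ring
    have h2 : Real.exp (-(l * |t|)) ≤ 1 := Real.exp_le_one_iff.2 (by
      have : 0 ≤ l * |t| := by positivity
      linarith)
    calc Real.exp (-(l * |t|)) * ‖P w |t|‖
        ≤ Real.exp (-(l * |t|)) * (‖x₀‖ + K * ‖w‖ / l * Real.exp (l * |t|)) := by gcongr
      _ = Real.exp (-(l * |t|)) * ‖x₀‖
          + K * ‖w‖ / l * (Real.exp (-(l * |t|)) * Real.exp (l * |t|)) := by ring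
      _ ≤ 1 * ‖x₀‖ + K * ‖w‖ / l * 1 := by rw [hexp]; gcongr
      _ = _ := by ring
  -- Time enters through |t|: the fixed point lives on all of ℝ, while the integral estimates, and
  -- the equation itself, are needed only for t ≥ 0.
  let Φ : (ℝ →ᵇ X) → (ℝ →ᵇ X) := fun w =>
    BoundedContinuousFunction.ofNormedAddCommGroup (fun t => Real.exp (-(l * |t|)) • P w |t|)
      ((by fun_prop : Continuous fun t : ℝ => Real.exp (-(l * |t|))).smul
        ((hPc w).comp continuous_abs)) _ (hb w)
  have hΦ : ContractingWith (K / (K + 1)) Φ := by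
    constructor
    · rw [div_lt_one (by positivity)]
      exact lt_add_one K
    · refine LipschitzWith.of_dist_le_mul fun w₁ w₂ => ?_
      rw [dist_eq_norm]
      refine (BoundedContinuousFunction.norm_le (by positivity)).2 fun t => ?_
      have e : (Φ w₁ - Φ w₂) t = Real.exp (-(l * |t|)) •
          ∫ s in (0 : ℝ)..|t|, (F s (Real.exp (l * s) • w₁ s) - F s (Real.exp (l * s) • w₂ s)) := by
        rw [intervalIntegral.integral_sub ((hc _).intervalIntegrable _ _)
          ((hc _).intervalIntegrable _ _)]
        change Real.exp (-(l * |t|)) • P w₁ |t| - Real.exp (-(l * |t|)) • P w₂ |t| = _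
        rw [← smul_sub]
        simp [P]
      rw [e, norm_smul, Real.norm_eq_abs, Real.abs_exp]
      have h1 := norm_integral_le_of_norm_le_exp (M := K * dist w₁ w₂) hl (abs_nonneg t)
        (f := fun s => F s (Real.exp (l * s) • w₁ s) - F s (Real.exp (l * s) • w₂ s))
        (by positivity) (fun s _ => by
          rw [← dist_eq_norm]
          refine ((hLip s).dist_le_mul _ _).trans ?_
          rw [dist_eq_norm, ← smul_sub, norm_smul, Real.norm_eq_abs, Real.abs_exp, ← dist_eq_norm]
          have := BoundedContinuousFunction.dist_coe_le_dist (f := w₁) (g := w₂) s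
          calc (K : ℝ) * (Real.exp (l * s) * dist (w₁ s) (w₂ s))
              ≤ K * (Real.exp (l * s) * dist w₁ w₂) := by gcongr
            _ = _ := by ring)
      calc _ ≤ Real.exp (-(l * |t|)) * (K * dist w₁ w₂ / l * Real.exp (l * |t|)) := by gcongr
        _ = K * dist w₁ w₂ / l * (Real.exp (-(l * |t|)) * Real.exp (l * |t|)) := by ring
        _ = ((K / (K + 1) : ℝ≥0) : ℝ) * dist w₁ w₂ := by
          rw [hexp]; push_cast; rw [hl_def]; ring
  have : Nonempty (ℝ →ᵇ X) := ⟨0⟩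
  set w := ContractingWith.fixedPoint Φ hΦ
  have hw : Φ w = w := hΦ.fixedPoint_isFixedPt
  refine ⟨P w, by simp [P], hPc w, fun t ht => ?_⟩
  have h1 : w t = Real.exp (-(l * t)) • P w t := by
    conv_lhs => rw [← hw]
    change Real.exp (-(l * |t|)) • P w |t| = _
    rw [abs_of_nonneg ht]
  have h2 := hP w t
  rw [h1, smul_smul, mul_comm, hexp, one_smul] at h2
  exact h2

/-- A closed set is forward invariant under a Lipschitz vector field if short Euler steps starting
in the set remain in the set. -/
theorem ode_mem_of_euler_step_mem {F : ℝ → X → X} {K : ℝ≥0} {B : Set X} {y : ℝ → X} {T h₀ : ℝ}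
    (hLip : ∀ t, LipschitzWith K (F t)) (hB : IsClosed B) (hh₀ : 0 < h₀)
    (hstep : ∀ t ∈ Ico 0 T, ∀ q ∈ B, ∀ h, 0 < h → h ≤ h₀ → q + h • F t q ∈ B)
    (hc : ContinuousOn y (Icc 0 T))
    (hy : ∀ t ∈ Ico 0 T, HasDerivWithinAt y (F t (y t)) (Ici t) t) (hy0 : y 0 ∈ B) :
    ∀ t ∈ Icc 0 T, y t ∈ B := by
  have hne : B.Nonempty := ⟨_, hy0⟩
  have key : ∀ t ∈ Icc 0 T, Metric.infDist (y t) B ≤ gronwallBound 0 K 0 (t - 0) := by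
    refine le_gronwallBound_of_liminf_deriv_right_le (f' := fun t => K * Metric.infDist (y t) B)
      ((Metric.continuous_infDist_pt B).comp_continuousOn hc) ?_ ?_ ?_
    · intro t ht r hr
      refine Eventually.frequently ?_
      have hd := (hasDerivWithinAt_iff_isLittleO.1 (hy t ht)).mono
        (nhdsWithin_mono t Ioi_subset_Ici_self)
      have hε : 0 < (r - K * Metric.infDist (y t) B) / 2 := by linarith
      have h1 := hd.def hε
      have h2 : ∀ᶠ z in 𝓝[>] t, z ∈ Ioc t (t + h₀) :=
        Ioc_mem_nhdsGT (by linarith)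
      filter_upwards [h1, h2] with z hz hzt
      have hpos : 0 < z - t := by linarith [hzt.1]
      -- For q in B the Euler step from q stays in B, and it lies within (1 + K(z - t)) dist(y t, q)
      -- of the Euler step from y t. Taking the infimum over q, the distance to B grows at rate at
      -- most K, so by Gronwall it stays 0.
      have h3 : Metric.infDist (y t + (z - t) • F t (y t)) B
          ≤ (1 + K * (z - t)) * Metric.infDist (y t) B := by
        have hk : 0 < 1 + K * (z - t) := by positivity
        rw [← div_le_iff₀' hk]
        refine (Metric.le_infDist hne).2 fun q hq => ?_
        rw [div_le_iff₀' hk]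
        refine (Metric.infDist_le_dist_of_mem
          (hstep t ht q hq (z - t) hpos (by linarith [hzt.2]))).trans ?_
        refine (dist_add_add_le _ _ _ _).trans ?_
        have := (hLip t).dist_le_mul (y t) q
        rw [dist_smul₀, Real.norm_eq_abs, abs_of_pos hpos]
        nlinarith
      have h4 : Metric.infDist (y z) B ≤ Metric.infDist (y t + (z - t) • F t (y t)) B
          + dist (y z) (y t + (z - t) • F t (y t)) := Metric.infDist_le_infDist_add_dist
      rw [dist_eq_norm, show y z - (y t + (z - t) • F t (y t))
        = y z - y t - (z - t) • F t (y t) by abel] at h4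
      rw [Real.norm_eq_abs, abs_of_pos hpos] at hz
      rw [inv_mul_lt_iff₀ hpos]
      nlinarith
    · rw [Metric.infDist_zero_of_mem hy0]
    · intro t _; simp
  intro t ht
  have := key t ht
  rw [gronwallBound_ε0_δ0] at this
  exact (hB.mem_iff_infDist_zero hne).2 (le_antisymm this Metric.infDist_nonneg)

end ODE

/-! ### Translations on L², weak derivatives and the Sobolev embedding. -/

section Shift

variable {F : Type*} [NormedAddCommGroup F] [NormedSpace ℝ F]

/-- Translation `f ↦ f (· + h)` on `L²`. -/
def shift (h : ℝ) : L2 F ≃ₗᵢ[ℝ] L2 F :=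
  LinearIsometryEquiv.ofSurjective
    (Lp.compMeasurePreservingₗᵢ ℝ (fun z : ℝ => z + h) (measurePreserving_add_right volume h)) <| by
    intro f
    refine ⟨Lp.compMeasurePreservingₗᵢ ℝ (fun z : ℝ => z + -h)
      (measurePreserving_add_right volume (-h)) f, ?_⟩
    refine Lp.ext ?_
    have h1 := Lp.coeFn_compMeasurePreserving f (measurePreserving_add_right volume (-h))
    have h2 := Lp.coeFn_compMeasurePreserving
      (Lp.compMeasurePreservingₗᵢ ℝ (fun z : ℝ => z + -h)
        (measurePreserving_add_right volume (-h)) f) (measurePreserving_add_right volume h)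
    filter_upwards [h2, (measurePreserving_add_right volume h).quasiMeasurePreserving.ae h1]
      with z hz hz'
    refine hz.trans (hz'.trans ?_)
    simp

theorem coeFn_shift (h : ℝ) (f : L2 F) : shift h f =ᵐ[volume] fun z => f (z + h) :=
  Lp.coeFn_compMeasurePreserving f (measurePreserving_add_right volume h)

theorem ae_comp_add {p : ℝ → Prop} (hp : ∀ᵐ z, p z) (h : ℝ) : ∀ᵐ z, p (z + h) :=
  (measurePreserving_add_right volume h).quasiMeasurePreserving.ae hp

@[simp] theorem shift_zero (f : L2 F) : shift 0 f = f := by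
  refine Lp.ext ((coeFn_shift 0 f).trans ?_)
  simp

theorem shift_shift (a b : ℝ) (f : L2 F) : shift a (shift b f) = shift (a + b) f := by
  refine Lp.ext ?_
  filter_upwards [coeFn_shift a (shift b f), coeFn_shift (a + b) f,
    ae_comp_add (coeFn_shift b f) a] with z h1 h2 h3
  rw [h1, h2, h3, add_assoc]

theorem continuous_shift (f : L2 F) : Continuous fun h => shift h f := by
  have hg : Continuous fun h : ℝ => (ContinuousMap.mk (fun z : ℝ => z + h) : C(ℝ, ℝ)) :=
    ContinuousMap.continuous_of_continuous_uncurry _ (by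
      change Continuous fun p : ℝ × ℝ => p.2 + p.1
      fun_prop)
  exact (continuous_const (y := f)).compMeasurePreservingLp hg
    (fun h => measurePreserving_add_right volume h) (by simp)

/-- The bounded functional `g ↦ ∫ w g` on `L²`, for a weight `w ∈ L²`. -/
def weightedIntegral [CompleteSpace F] (w : L2 ℝ) : L2 F →L[ℝ] F :=
  (ContinuousLinearMap.lsmul ℝ ℝ).lpPairing volume 2 2 w

theorem weightedIntegral_apply [CompleteSpace F] {φ : ℝ → ℝ} (hφ : MemLp φ 2) (g : L2 F) :
    weightedIntegral (hφ.toLp φ) g = ∫ z, φ z • g z := by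
  rw [weightedIntegral, ContinuousLinearMap.lpPairing_eq_integral]
  refine integral_congr_ae ?_
  filter_upwards [hφ.coeFn_toLp] with z hz
  simp [hz]

theorem integral_smul_shift (φ : ℝ → ℝ) (h : ℝ) (f : L2 F) :
    ∫ z, φ z • shift h f z = ∫ z, φ (z - h) • f z := by
  rw [← integral_add_right_eq_self (fun z => φ (z - h) • f z) h]
  refine integral_congr_ae ?_
  filter_upwards [coeFn_shift h f] with z hz
  simp [hz]

theorem intervalIntegrable_L2 {F : Type*} [NormedAddCommGroup F] (g : L2 F) (a b : ℝ) :
    IntervalIntegrable (fun z => g z) volume a b :=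
  (((Lp.memLp g).locallyIntegrable (by simp)).integrableOn_isCompact
    isCompact_uIcc).mono_set uIoc_subset_uIcc |> intervalIntegrable_iff.2

variable [CompleteSpace F]

theorem eq_of_forall_testFunction_integral_eq {f g : L2 F}
    (h : ∀ φ : ℝ → ℝ, ContDiff ℝ ∞ φ → HasCompactSupport φ →
      ∫ z, φ z • f z = ∫ z, φ z • g z) : f = g :=
  Lp.ext (ae_eq_of_integral_contDiff_smul_eq ((Lp.memLp f).locallyIntegrable (by simp))
    ((Lp.memLp g).locallyIntegrable (by simp)) h)

/-- After a change of variables the integral is the convolution of f with the reflected test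
function, so the derivative in h falls on the smooth factor. -/
theorem hasDerivAt_integral_smul_shift {φ : ℝ → ℝ} (hφ : ContDiff ℝ ∞ φ)
    (hs : HasCompactSupport φ) (f : L2 F) (h : ℝ) :
    HasDerivAt (fun h => ∫ z, φ z • shift h f z) (-∫ z, deriv φ z • shift h f z) h := by
  have hfl : LocallyIntegrable (fun z => f z) :=
    (Lp.memLp f).locallyIntegrable (by simp)
  have hs' : HasCompactSupport fun z : ℝ => φ (-z) :=
    hs.comp_homeomorph (Homeomorph.neg ℝ)
  have hφ' : ContDiff ℝ ∞ fun z : ℝ => φ (-z) := hφ.comp contDiff_neg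
  have key := hs'.hasDerivAt_convolution_right
    ((ContinuousLinearMap.lsmul ℝ ℝ : ℝ →L[ℝ] F →L[ℝ] F).flip) hfl (hφ'.of_le (by simp)) h
  convert! key using 1
  · ext x
    rw [integral_smul_shift]
    simp [convolution]
  · rw [integral_smul_shift, ← integral_neg]
    simp only [convolution, deriv_comp_neg]
    simp

theorem HasWeakDeriv.shift {f f' : L2 F} (hf : HasWeakDeriv f f') (h : ℝ) :
    HasWeakDeriv (shift h f) (shift h f') := by
  intro φ hφ hs
  have h1 := hf (fun z => φ (z - h)) (hφ.comp (contDiff_id.sub contDiff_const))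
    (hs.comp_homeomorph (Homeomorph.subRight h))
  simp only [deriv_comp_sub_const] at h1
  rw [integral_smul_shift, integral_smul_shift, h1]

/-- Fundamental theorem of calculus along the translation orbit, checked after pairing with test
functions. It makes the weak derivative the generator of translations; differentiability of the
orbit in L² and uniqueness of weak derivatives follow. -/
theorem HasWeakDeriv.shift_sub_eq {f f' : L2 F} (hf : HasWeakDeriv f f') (h : ℝ) :
    GapSoliton.shift h f - f = ∫ s in (0 : ℝ)..h, GapSoliton.shift s f' := by
  refine eq_of_forall_testFunction_integral_eq fun φ hφ hs => ?_
  have hm : MemLp φ 2 := hφ.continuous.memLp_of_hasCompactSupport hs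
  rw [← weightedIntegral_apply hm, ← weightedIntegral_apply hm,
    ← ContinuousLinearMap.intervalIntegral_comp_comm _
      ((continuous_shift f').intervalIntegrable _ _), map_sub]
  have hd : ∀ s, HasDerivAt (fun s => weightedIntegral (hm.toLp φ) (GapSoliton.shift s f))
      (weightedIntegral (hm.toLp φ) (GapSoliton.shift s f')) s := by
    intro s
    have := hasDerivAt_integral_smul_shift hφ hs f s
    simp only [weightedIntegral_apply]
    rwa [(hf.shift s) φ hφ hs, neg_neg] at this
  rw [intervalIntegral.integral_eq_sub_of_hasDerivAt (fun s _ => hd s)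
    (((weightedIntegral _).continuous.comp (continuous_shift f')).intervalIntegrable _ _)]
  simp

theorem HasWeakDeriv.hasDerivAt_shift {f f' : L2 F} (hf : HasWeakDeriv f f') (h : ℝ) :
    HasDerivAt (fun h => GapSoliton.shift h f) (GapSoliton.shift h f') h := by
  have e : (fun h => GapSoliton.shift h f) = fun h =>
      f + ∫ s in (0 : ℝ)..h, GapSoliton.shift s f' := by
    ext1 h
    rw [← hf.shift_sub_eq]; abel
  rw [e]
  exact (intervalIntegral.integral_hasDerivAt_right ((continuous_shift f').intervalIntegrable _ _)
      (continuous_shift f').stronglyMeasurable.stronglyMeasurableAtFilter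
      (continuous_shift f').continuousAt).const_add f

theorem HasWeakDeriv.unique {f f' f'' : L2 F} (h : HasWeakDeriv f f') (h' : HasWeakDeriv f f'') :
    f' = f'' := by
  simpa using (h.hasDerivAt_shift 0).unique (h'.hasDerivAt_shift 0)

theorem norm_intervalIntegral_L2_le (g : L2 F) {a b : ℝ} (hab : a ≤ b) (hb : b ≤ a + 1) :
    ‖∫ z in a..b, g z‖ ≤ ‖g‖ := by
  rw [intervalIntegral.integral_of_le hab]
  have hi : IntegrableOn (fun z => g z) (Ioc a b) := (intervalIntegrable_L2 g a b).1
  refine (norm_integral_le_integral_norm _).trans ?_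
  rw [integral_norm_eq_lintegral_enorm hi.1, ← eLpNorm_one_eq_lintegral_enorm, Lp.norm_def]
  refine ENNReal.toReal_mono (Lp.eLpNorm_ne_top g) ?_
  refine (eLpNorm_le_eLpNorm_mul_rpow_measure_univ (p := 1) (q := 2) (by norm_num) hi.1).trans ?_
  have h1 : eLpNorm (fun z => g z) 2 (volume.restrict (Ioc a b)) ≤ eLpNorm (fun z => g z) 2 volume :=
    eLpNorm_mono_measure _ Measure.restrict_le_self
  refine (mul_le_mul' h1 (ENNReal.rpow_le_one (z := 1 / (1 : ℝ≥0∞).toReal - 1 / (2 : ℝ≥0∞).toReal)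
    ?_ (by norm_num))).trans (mul_one _).le
  rw [Measure.restrict_apply_univ, Real.volume_Ioc]
  exact ENNReal.ofReal_le_one.2 (by linarith)

/-- Up to sign the integral over the moving window pairs the translated function with the indicator
of the fixed interval between 0 and x, so differentiability of the translation orbit passes to it.
-/
theorem hasDerivAt_intervalIntegral_shift {f f' : L2 F} (hf : HasWeakDeriv f f') (x h : ℝ) :
    HasDerivAt (fun h => ∫ z in h..x + h, f z) (∫ z in h..x + h, f' z) h := by
  have hm : MemLp (indicator (uIoc 0 x) fun _ => (1 : ℝ)) 2 :=
    memLp_indicator_const 2 measurableSet_uIoc 1 (Or.inr (by simp [uIoc]))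
  have e : ∀ g : L2 F, ∀ h, ∫ z in h..x + h, g z = (if 0 ≤ x then (1 : ℝ) else -1) •
      weightedIntegral (hm.toLp _) (GapSoliton.shift h g) := by
    intro g h
    have h1 : ∫ z in h..x + h, g z = ∫ z in (0 : ℝ)..x, GapSoliton.shift h g z := by
      rw [intervalIntegral.integral_congr_ae (g := fun z => g (z + h)) (f := GapSoliton.shift h g),
        intervalIntegral.integral_comp_add_right (fun z => g z), zero_add]
      filter_upwards [coeFn_shift h g] with z hz _ using hz
    rw [h1, intervalIntegral.intervalIntegral_eq_integral_uIoc, weightedIntegral_apply,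
      ← integral_indicator measurableSet_uIoc]
    congr 2
    ext z
    by_cases hz : z ∈ uIoc 0 x <;> simp [hz]
  simp only [e]
  exact ((weightedIntegral (hm.toLp _)).hasFDerivAt.comp_hasDerivAt h
    (hf.hasDerivAt_shift h)).const_smul _

/-- One-dimensional Sobolev embedding `H¹ ⊆ L^∞`. -/
theorem HasWeakDeriv.ae_norm_le {f f' : L2 F} (hf : HasWeakDeriv f f') :
    ∀ᵐ z, ‖f z‖ ≤ ‖f‖ + ‖f'‖ := by
  have hfl : LocallyIntegrable (fun z => f z) := (Lp.memLp f).locallyIntegrable (by simp)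
  have hae := _root_.LocallyIntegrable.ae_hasDerivAt_integral hfl
  obtain ⟨a, ha⟩ := hae.exists
  -- Differentiability of the primitive J at the single point a spreads to every x: J(y) is J(y - (x
  -- - a)) plus the integral over a window of fixed signed length x - a, and y - (x - a) is near a
  -- when y is near x.
  have hJ : ∀ x, HasDerivAt (fun x => ∫ t in (0 : ℝ)..x, f t) (f a + ∫ t in a..x, f' t) x := by
    intro x
    have h1 := (hasDerivAt_intervalIntegral_shift hf (x - a) a).add (ha 0)
    rw [sub_add_cancel] at h1
    have h2 : HasDerivAt (fun y : ℝ => y - (x - a)) 1 x := (hasDerivAt_id x).sub_const _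
    have h3 : HasDerivAt (fun y => (∫ z in y..(x - a) + y, f z) + ∫ t in (0 : ℝ)..y, f t)
        (f a + ∫ t in a..x, f' t) (x - (x - a)) := by
      rw [sub_sub_cancel, add_comm (f a)]; exact h1
    have h4 := h3.scomp x h2
    rw [one_smul] at h4
    convert! h4 using 1
    ext y
    simp only [Function.comp_apply]
    rw [add_comm, intervalIntegral.integral_add_adjacent_intervals (intervalIntegrable_L2 f _ _)
      (intervalIntegrable_L2 f _ _)]
    simp
  have hr : ∀ z, f z = f a + ∫ t in a..z, f' t → ‖f z‖ ≤ ‖f‖ + ‖f'‖ := by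
    intro z hz
    -- On [z, z+1] the derivative of J differs from f z by the integral of f' over [z, x], at most
    -- ‖f'‖. Hence f z is within ‖f'‖ of the mean of f over that interval, which is at most ‖f‖.
    have h1 := norm_image_sub_le_of_norm_deriv_le_segment' (a := z) (b := z + 1) (C := ‖f'‖)
      (f := fun x => (∫ t in (0 : ℝ)..x, f t) - x • f z)
      (f' := fun x => (f a + ∫ t in a..x, f' t) - (1 : ℝ) • f z)
      (fun x _ => ((hJ x).sub ((hasDerivAt_id x).smul_const (f z))).hasDerivWithinAt)
      (fun x hx => by
        rw [hz, one_smul, add_sub_add_left_eq_sub,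
          intervalIntegral.integral_interval_sub_left (intervalIntegrable_L2 f' _ _)
            (intervalIntegrable_L2 f' _ _)]
        exact norm_intervalIntegral_L2_le f' hx.1 hx.2.le) (z + 1) (by simp)
    have h2 : (∫ t in (0 : ℝ)..(z + 1), f t) - (z + 1) • f z - ((∫ t in (0 : ℝ)..z, f t) - z • f z)
        = (∫ t in z..(z + 1), f t) - f z := by
      rw [← intervalIntegral.integral_interval_sub_left (intervalIntegrable_L2 f 0 (z + 1))
        (intervalIntegrable_L2 f 0 z), add_smul, one_smul]
      abel
    rw [h2] at h1
    have h3 := norm_intervalIntegral_L2_le f (a := z) (b := z + 1) (by simp) le_rfl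
    have h4 : ‖f z‖ ≤ ‖∫ t in z..(z + 1), f t‖ + ‖(∫ t in z..(z + 1), f t) - f z‖ := by
      have := norm_sub_le (∫ t in z..(z + 1), f t) ((∫ t in z..(z + 1), f t) - f z)
      rwa [sub_sub_cancel] at this
    linarith
  filter_upwards [hae] with z hz
  exact hr z ((hz 0).unique (hJ z))

end Shift

/-- Banach–Alaoglu transported by the Riesz isomorphism. An ultrafilter finer than l takes the place
of a subsequence, and closed balls are weakly closed, so the bound r survives. -/
theorem exists_weak_limit {H : Type*} [NormedAddCommGroup H] [InnerProductSpace ℝ H]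
    [CompleteSpace H] {α : Type*} {l : Filter α} [NeBot l] {x : α → H} {r : ℝ}
    (hx : ∀ᶠ a in l, ‖x a‖ ≤ r) :
    ∃ (x₀ : H) (U : Ultrafilter α), ‖x₀‖ ≤ r ∧ (U : Filter α) ≤ l ∧
      ∀ g : H →L[ℝ] ℝ, Tendsto (fun a => g (x a)) U (𝓝 (g x₀)) := by
  let D : α → WeakDual ℝ H := fun a =>
    StrongDual.toWeakDual (InnerProductSpace.toDual ℝ H (x a))
  have hU := Ultrafilter.of_le l
  have hmem : ((Ultrafilter.of l).map D : Filter (WeakDual ℝ H)) ≤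
      𝓟 (WeakDual.toStrongDual ⁻¹' Metric.closedBall (0 : StrongDual ℝ H) r) := by
    rw [le_principal_iff]
    change ∀ᶠ a in (Ultrafilter.of l : Filter α), D a ∈ _
    filter_upwards [hU hx] with a ha
    simpa [D] using ha
  obtain ⟨ξ, hξ, hlim⟩ := (WeakDual.isCompact_closedBall (𝕜 := ℝ) (0 : StrongDual ℝ H) r)
    |>.ultrafilter_le_nhds _ hmem
  refine ⟨(InnerProductSpace.toDual ℝ H).symm (WeakDual.toStrongDual ξ), Ultrafilter.of l,
    by simpa using hξ, hU, fun g => ?_⟩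
  have h1 : Tendsto (fun a => D a ((InnerProductSpace.toDual ℝ H).symm g)) (Ultrafilter.of l)
      (𝓝 (ξ ((InnerProductSpace.toDual ℝ H).symm g))) :=
    ((WeakDual.eval_continuous ((InnerProductSpace.toDual ℝ H).symm g)).tendsto ξ).comp hlim
  have h2 : ∀ v : H, g v = inner ℝ v ((InnerProductSpace.toDual ℝ H).symm g) := fun v => by
    rw [real_inner_comm, InnerProductSpace.toDual_symm_apply]
  have h3 : ξ ((InnerProductSpace.toDual ℝ H).symm g)
      = g ((InnerProductSpace.toDual ℝ H).symm (WeakDual.toStrongDual ξ)) := by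
    rw [h2, InnerProductSpace.toDual_symm_apply]; rfl
  rw [← h3]
  refine h1.congr fun a => ?_
  rw [h2]; rfl

/-- Leibniz rule for a strongly continuous family of isometries acting on a curve. -/
theorem hasDerivWithinAt_isometry_apply {X : Type*} [NormedAddCommGroup X] [NormedSpace ℝ X]
    {S : ℝ → X ≃ₗᵢ[ℝ] X} (hS : ∀ x, Continuous fun t => S t x) {x : ℝ → X} {x' d : X} {s : Set ℝ}
    {t : ℝ} (hx : HasDerivWithinAt x x' s t)
    (hd : HasDerivWithinAt (fun τ => S τ (x t)) d s t) :
    HasDerivWithinAt (fun τ => S τ (x τ)) (d + S t x') s t := by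
  -- S is only strongly continuous, so S τ (x τ) is split as S τ (x t) + S τ (x τ - x t). In the
  -- second term the remainder of x is o(τ - t) because S τ is isometric, and S τ x' tends to S t x'
  -- by strong continuity.
  have key : HasDerivWithinAt (fun τ => S τ (x τ - x t)) (S t x') s t := by
    rw [hasDerivWithinAt_iff_isLittleO] at hx ⊢
    have h1 : (fun τ => S τ (x τ - x t - (τ - t) • x')) =o[𝓝[s] t] fun τ => τ - t :=
      (hx.norm_left.congr_left fun τ => ((S τ).norm_map _).symm).of_norm_left
    have h2 : (fun τ => (τ - t) • (S τ x' - S t x')) =o[𝓝[s] t] fun τ => τ - t := by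
      have h3 : (fun τ => S τ x' - S t x') =o[𝓝[s] t] fun _ => (1 : ℝ) := by
        rw [Asymptotics.isLittleO_one_iff]
        have := ((hS x').tendsto t).sub_const (S t x')
        rw [sub_self] at this
        exact this.mono_left nhdsWithin_le_nhds
      simpa using (Asymptotics.isBigO_refl (fun τ : ℝ => τ - t) (𝓝[s] t)).smul_isLittleO h3
    refine (h1.add h2).congr_left fun τ => ?_
    simp only [map_sub, map_smul, sub_self, map_zero, smul_sub, sub_zero]
    abel
  have := hd.add key
  refine this.congr_of_eventuallyEq (Eventually.of_forall fun τ => ?_) ?_ <;> simp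

/-! ### Vectors of L² functions and difference quotients. -/

section Vec

variable {ι : Type*} [Fintype ι] {F : Type*} [NormedAddCommGroup F] [InnerProductSpace ℝ F]

/-- Vectors of square integrable functions. -/
abbrev Vec (ι F : Type*) [Fintype ι] [NormedAddCommGroup F] : Type _ := PiLp 2 (fun _ : ι => L2 F)

/-- The flow of the transport system `∂_t y_j = c_j ∂_z y_j`. -/
def diagShift (c : ι → ℝ) (t : ℝ) : Vec ι F ≃ₗᵢ[ℝ] Vec ι F :=
  LinearIsometryEquiv.piLpCongrRight 2 fun j => shift (c j * t)

@[simp] theorem diagShift_apply (c : ι → ℝ) (t : ℝ) (y : Vec ι F) (j : ι) :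
    diagShift c t y j = shift (c j * t) (y j) := rfl

/-- Componentwise weak derivatives. -/
def HasWeakDerivs (y y' : Vec ι F) : Prop := ∀ j, HasWeakDeriv (y j) (y' j)

theorem HasWeakDerivs.mem {y y' : Vec ι F} (h : HasWeakDerivs y y') (j : ι) :
    WithLp.toLp 2 (y j, y' j) ∈ H1 F := h j

theorem HasWeakDerivs.sub {y y' w w' : Vec ι F} (h : HasWeakDerivs y y')
    (h' : HasWeakDerivs w w') : HasWeakDerivs (y - w) (y' - w') := fun j =>
  (H1 F).sub_mem (h.mem j) (h'.mem j)

theorem hasDerivWithinAt_vec {y : ℝ → Vec ι F} {y' : Vec ι F} {s : Set ℝ} {t : ℝ} :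
    HasDerivWithinAt y y' s t ↔ ∀ j, HasDerivWithinAt (fun τ => y τ j) (y' j) s t := by
  simp only [hasDerivWithinAt_iff_hasFDerivWithinAt]
  rw [hasFDerivWithinAt_piLp 2]
  refine forall_congr' fun j => ?_
  have : (PiLp.proj 2 _ j : Vec ι F →L[ℝ] L2 F) ∘L ContinuousLinearMap.toSpanSingleton ℝ y'
      = ContinuousLinearMap.toSpanSingleton ℝ (y' j) := by
    ext1; simp
  rw [this]

theorem hasDerivAt_vec {y : ℝ → Vec ι F} {y' : Vec ι F} {t : ℝ} :
    HasDerivAt y y' t ↔ ∀ j, HasDerivAt (fun τ => y τ j) (y' j) t := by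
  simp only [← hasDerivWithinAt_univ, hasDerivWithinAt_vec]

theorem continuous_diagShift (c : ι → ℝ) (y : Vec ι F) : Continuous fun t => diagShift c t y := by
  refine (PiLp.continuous_toLp 2 _).comp (continuous_pi fun j => ?_)
  exact (continuous_shift (y j)).comp (by fun_prop : Continuous fun t : ℝ => c j * t)

variable [CompleteSpace F]

theorem HasWeakDerivs.unique {y y' y'' : Vec ι F} (h : HasWeakDerivs y y')
    (h' : HasWeakDerivs y y'') : y' = y'' :=
  PiLp.ext fun j => (h j).unique (h' j)

theorem HasWeakDerivs.diagShift {y y' : Vec ι F} (h : HasWeakDerivs y y') (c : ι → ℝ) (t : ℝ) :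
    HasWeakDerivs (diagShift c t y) (diagShift c t y') := fun j => (h j).shift _

theorem HasWeakDerivs.hasDerivAt_diagShift {y y' : Vec ι F} (h : HasWeakDerivs y y') (c : ι → ℝ)
    (t : ℝ) : HasDerivAt (fun τ => GapSoliton.diagShift c τ y)
      (GapSoliton.diagShift c t (WithLp.toLp 2 fun j => c j • y' j)) t := by
  refine hasDerivAt_vec.2 fun j => ?_
  have h1 := ((h j).hasDerivAt_shift (c j * t)).scomp t ((hasDerivAt_id t).const_mul (c j))
  simp only [diagShift_apply, map_smul]
  rw [mul_one] at h1
  exact h1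

/-- The pair of `y` and its difference quotient with step `h`. -/
def withQuotient (h : ℝ) : Vec ι F →L[ℝ] WithLp 2 (Vec ι F × Vec ι F) :=
  (WithLp.prodContinuousLinearEquiv 2 ℝ (Vec ι F) (Vec ι F)).symm.toContinuousLinearMap ∘L
    (ContinuousLinearMap.id ℝ (Vec ι F)).prod
      (h⁻¹ • ((diagShift 1 h).toContinuousLinearEquiv.toContinuousLinearMap -
        ContinuousLinearMap.id ℝ (Vec ι F)))

theorem withQuotient_apply (h : ℝ) (y : Vec ι F) :
    withQuotient h y = WithLp.toLp 2 (y, h⁻¹ • (diagShift 1 h y - y)) := rfl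

theorem norm_toLp_le_of_norm_le {y w y' w' : Vec ι F} (h : ‖y‖ ≤ ‖w‖) (h' : ‖y'‖ ≤ ‖w'‖) :
    ‖WithLp.toLp 2 (y, y')‖ ≤ ‖WithLp.toLp 2 (w, w')‖ := by
  rw [WithLp.prod_norm_eq_of_L2, WithLp.prod_norm_eq_of_L2]
  gcongr
  exacts [h, h']

/-- The translation orbit has speed ‖y'‖, so this is the mean value inequality. For h = 0 the
convention 0⁻¹ = 0 makes the quotient vanish. -/
theorem HasWeakDerivs.norm_withQuotient_le {y y' : Vec ι F} (hy : HasWeakDerivs y y') (h : ℝ) :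
    ‖withQuotient h y‖ ≤ ‖WithLp.toLp 2 (y, y')‖ := by
  refine norm_toLp_le_of_norm_le le_rfl ?_
  have h1 := convex_univ.norm_image_sub_le_of_norm_hasDerivWithin_le (C := ‖y'‖)
    (f := fun τ => GapSoliton.diagShift (1 : ι → ℝ) τ y) (x := 0) (y := h)
    (fun t _ => (hy.hasDerivAt_diagShift 1 t).hasDerivWithinAt)
    (fun t _ => by rw [LinearIsometryEquiv.norm_map]; simp) (mem_univ _) (mem_univ _)
  have h0 : GapSoliton.diagShift (1 : ι → ℝ) 0 y = y := PiLp.ext fun j => by simp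
  rw [h0, sub_zero, Real.norm_eq_abs] at h1
  change ‖h⁻¹ • (GapSoliton.diagShift 1 h y - y)‖ ≤ ‖y'‖
  rw [norm_smul, norm_inv, Real.norm_eq_abs]
  rcases eq_or_ne h 0 with rfl | hh
  · simp
  · rw [inv_mul_le_iff₀ (abs_pos.2 hh), mul_comm]; exact h1

/-- The pairs (y, quotient) have a weak limit as h → 0. Its first component is y, and its second is
identified on test functions, where the quotients converge to minus the integral against φ'. Keeping
the same r is what leaves the final H¹ estimate without a prefactor. -/
theorem exists_hasWeakDerivs_of_norm_withQuotient_le {y : Vec ι F} {r : ℝ}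
    (hr : ∀ h, h ≠ 0 → ‖withQuotient h y‖ ≤ r) :
    ∃ y', HasWeakDerivs y y' ∧ ‖WithLp.toLp 2 (y, y')‖ ≤ r := by
  have hev : ∀ᶠ h in 𝓝[≠] (0 : ℝ), ‖withQuotient h y‖ ≤ r := by
    filter_upwards [self_mem_nhdsWithin] with h hh using hr h hh
  obtain ⟨p, U, hp, hU, hlim⟩ := exists_weak_limit hev
  have hfst : p.fst = y := by
    refine ext_inner_left ℝ fun v => ?_
    have h1 := hlim (innerSL ℝ v ∘L ContinuousLinearMap.fst ℝ _ _ ∘L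
      (WithLp.prodContinuousLinearEquiv 2 ℝ (Vec ι F) (Vec ι F)).toContinuousLinearMap)
    exact tendsto_nhds_unique h1 tendsto_const_nhds
  refine ⟨p.snd, fun j φ hφ hs => ?_, ?_⟩
  · have hm : MemLp φ 2 := hφ.continuous.memLp_of_hasCompactSupport hs
    refine ext_inner_left ℝ fun v => ?_
    have h1 := hlim (innerSL ℝ v ∘L weightedIntegral (hm.toLp φ) ∘L PiLp.proj 2 _ j ∘L
      ContinuousLinearMap.snd ℝ _ _ ∘L
      (WithLp.prodContinuousLinearEquiv 2 ℝ (Vec ι F) (Vec ι F)).toContinuousLinearMap)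
    have h2 := (hasDerivAt_integral_smul_shift hφ hs (y j) 0).tendsto_slope_zero.mono_left hU
    have h3 := ((innerSL ℝ v).continuous.tendsto _).comp h2
    have h4 : ∀ h : ℝ, (innerSL ℝ v ∘L weightedIntegral (hm.toLp φ) ∘L PiLp.proj 2 _ j ∘L
      ContinuousLinearMap.snd ℝ _ _ ∘L
      (WithLp.prodContinuousLinearEquiv 2 ℝ (Vec ι F) (Vec ι F)).toContinuousLinearMap)
        (withQuotient h y) = inner ℝ v (h⁻¹ • ((∫ z, φ z • shift (0 + h) (y j) z)
          - ∫ z, φ z • shift 0 (y j) z)) := by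
      intro h
      have e : (withQuotient h y).snd j = h⁻¹ • (shift h (y j) - y j) := by
        simp [withQuotient_apply]
      change inner ℝ v (weightedIntegral (hm.toLp φ) ((withQuotient h y).snd j)) = _
      rw [e, map_smul, map_sub, weightedIntegral_apply, weightedIntegral_apply, zero_add,
        shift_zero]
    simp only [h4] at h1
    have h5 := tendsto_nhds_unique h1 h3
    change inner ℝ v (weightedIntegral (hm.toLp φ) (p.snd j)) = inner ℝ v _ at h5
    rw [weightedIntegral_apply, shift_zero] at h5
    rw [inner_neg_right, h5, inner_neg_right, neg_neg]
  · rw [← hfst]; exact hp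

end Vec

/-! ### Abstract semilinear transport equations. -/

section Semilinear

variable {ι : Type*} [Fintype ι] {F : Type*} [NormedAddCommGroup F] [InnerProductSpace ℝ F]
  [CompleteSpace F]

/-- A translation invariant, strongly continuous group of isometries of `L²`, whose generator is
the first order operator `y ↦ A ∂_z y`. -/
structure IsPropagator (S : ℝ → Vec ι F ≃ₗᵢ[ℝ] Vec ι F) (A : Vec ι F →L[ℝ] Vec ι F) : Prop where
  zero : ∀ y, S 0 y = y
  add : ∀ a b y, S a (S b y) = S (a + b) y
  cont : ∀ y, Continuous fun t => S t y
  comm : ∀ t h y, S t (diagShift 1 h y) = diagShift 1 h (S t y)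
  weak : ∀ t y y', HasWeakDerivs y y' → HasWeakDerivs (S t y) (S t y')
  deriv : ∀ y y', HasWeakDerivs y y' → ∀ t, HasDerivAt (fun t => S t y) (A (S t y')) t
  apply_comm : ∀ t y, S t (A y) = A (S t y)

/-- A nonlinearity that is globally Lipschitz on `L²` and has linear growth in `H¹`, the latter
being expressed by difference quotients. -/
structure IsTameNonlinearity (N : Vec ι F → Vec ι F) (K k : ℝ≥0) : Prop where
  lipschitz : LipschitzWith K N
  zero : N 0 = 0
  quotient : ∀ h y, ‖withQuotient h (N y)‖ ≤ k * ‖withQuotient h y‖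

variable {S : ℝ → Vec ι F ≃ₗᵢ[ℝ] Vec ι F} {A : Vec ι F →L[ℝ] Vec ι F} {N : Vec ι F → Vec ι F}
  {K k : ℝ≥0}

namespace IsPropagator

theorem neg_apply (hS : IsPropagator S A) (t : ℝ) (y : Vec ι F) : S (-t) (S t y) = y := by
  rw [hS.add, neg_add_cancel, hS.zero]

theorem apply_neg (hS : IsPropagator S A) (t : ℝ) (y : Vec ι F) : S t (S (-t) y) = y := by
  rw [hS.add, add_neg_cancel, hS.zero]

theorem norm_withQuotient (hS : IsPropagator S A) (t h : ℝ) (y : Vec ι F) :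
    ‖withQuotient h (S t y)‖ = ‖withQuotient h y‖ := by
  have e : h⁻¹ • (diagShift 1 h (S t y) - S t y) = S t (h⁻¹ • (diagShift 1 h y - y)) := by
    rw [map_smul, map_sub, hS.comm]
  rw [withQuotient_apply, withQuotient_apply, e, WithLp.prod_norm_eq_of_L2,
    WithLp.prod_norm_eq_of_L2]
  change √(‖S t y‖ ^ 2 + ‖S t _‖ ^ 2) = √(‖y‖ ^ 2 + ‖_‖ ^ 2)
  rw [LinearIsometryEquiv.norm_map, LinearIsometryEquiv.norm_map]
  rfl

theorem continuous_uncurry (hS : IsPropagator S A) :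
    Continuous fun p : ℝ × Vec ι F => S p.1 p.2 :=
  continuous_of_lipschitzWith_of_continuous (K := 1) (fun t => (S t).lipschitz) hS.cont

theorem lipschitzWith_conj (_ : IsPropagator S A) (hN : LipschitzWith K N) (t : ℝ) :
    LipschitzWith K fun y => S (-t) (N (S t y)) := by
  have := (S (-t)).lipschitz.comp (hN.comp (S t).lipschitz)
  rwa [one_mul, mul_one] at this

theorem continuous_conj (hS : IsPropagator S A) (hN : LipschitzWith K N) (y : Vec ι F) :
    Continuous fun t => S (-t) (N (S t y)) :=
  hS.continuous_uncurry.comp (continuous_neg.prodMk (hN.continuous.comp (hS.cont y)))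

/-- Passage to the moving frame removes the first order term. -/
theorem hasDerivWithinAt_conj (hS : IsPropagator S A) {u : ℝ → Vec ι F} {u' f : Vec ι F}
    {s : Set ℝ} {t : ℝ} (hu' : HasWeakDerivs (u t) u') (hu : HasDerivWithinAt u (A u' + f) s t) :
    HasDerivWithinAt (fun τ => S (-τ) (u τ)) (S (-t) f) s t := by
  have h1 : HasDerivWithinAt (fun τ => S (-τ) (u t)) (-A (S (-t) u')) s t := by
    have := (hS.deriv _ _ hu' (-t)).scomp t (hasDerivAt_neg t)
    rw [neg_one_smul] at this
    exact this.hasDerivWithinAt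
  have h2 := hasDerivWithinAt_isometry_apply (S := fun τ => S (-τ))
    (fun y => (hS.cont y).comp continuous_neg) hu h1
  rw [map_add, hS.apply_comm, neg_add_cancel_left] at h2
  exact h2

theorem hasDerivAt_of_conj (hS : IsPropagator S A) {y : ℝ → Vec ι F} {y' f : Vec ι F}
    {t : ℝ} (hy' : HasWeakDerivs (y t) y') (hy : HasDerivAt y (S (-t) f) t) :
    HasDerivAt (fun τ => S τ (y τ)) (A (S t y') + f) t := by
  have h2 := hasDerivWithinAt_isometry_apply hS.cont hy.hasDerivWithinAt
    (hS.deriv _ _ hy' t).hasDerivWithinAt (s := univ)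
  rw [hS.apply_neg] at h2
  exact hasDerivWithinAt_univ.1 h2

/-- In the moving frame both curves solve the same Lipschitz ODE in L², so Gronwall applies; right
derivatives suffice. -/
theorem eqOn_of_hasDerivWithinAt (hS : IsPropagator S A) (hN : LipschitzWith K N) {b : ℝ}
    {u u' v v' : ℝ → Vec ι F} (huc : ContinuousOn u (Icc 0 b)) (hvc : ContinuousOn v (Icc 0 b))
    (hu' : ∀ t ∈ Ico 0 b, HasWeakDerivs (u t) (u' t))
    (hv' : ∀ t ∈ Ico 0 b, HasWeakDerivs (v t) (v' t))
    (hu : ∀ t ∈ Ico 0 b, HasDerivWithinAt u (A (u' t) + N (u t)) (Ici t) t)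
    (hv : ∀ t ∈ Ico 0 b, HasDerivWithinAt v (A (v' t) + N (v t)) (Ici t) t)
    (h0 : u 0 = v 0) : EqOn u v (Icc 0 b) := by
  have key : ∀ w w' : ℝ → Vec ι F, ContinuousOn w (Icc 0 b) →
      (∀ t ∈ Ico 0 b, HasWeakDerivs (w t) (w' t)) →
      (∀ t ∈ Ico 0 b, HasDerivWithinAt w (A (w' t) + N (w t)) (Ici t) t) →
      ContinuousOn (fun t => S (-t) (w t)) (Icc 0 b) ∧ ∀ t ∈ Ico 0 b,
        HasDerivWithinAt (fun τ => S (-τ) (w τ)) (S (-t) (N (S t (S (-t) (w t))))) (Ici t) t := by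
    intro w w' hwc hw' hw
    refine ⟨hS.continuous_uncurry.comp_continuousOn (continuous_neg.continuousOn.prodMk hwc),
      fun t ht => ?_⟩
    rw [hS.apply_neg]
    exact hS.hasDerivWithinAt_conj (hw' t ht) (hw t ht)
  obtain ⟨h1, h2⟩ := key u u' huc hu' hu
  obtain ⟨h3, h4⟩ := key v v' hvc hv' hv
  intro t ht
  have h5 := dist_le_of_trajectories_ODE (fun t => hS.lipschitzWith_conj hN t) h1 h2 h3 h4
    (δ := 0) (by simp [h0]) t ht
  rw [zero_mul] at h5
  exact (S (-t)).injective (dist_le_zero.1 h5)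

/-- Global well-posedness in `H¹` of a semilinear transport equation with a tame nonlinearity. -/
theorem exists_solution (hS : IsPropagator S A) (hN : IsTameNonlinearity N K k)
    {u₀ u₀' : Vec ι F} (h₀ : HasWeakDerivs u₀ u₀') :
    ∃ u u' : ℝ → Vec ι F, u 0 = u₀ ∧ Continuous u ∧ ContinuousOn u' (Ici 0) ∧ ∀ t, 0 ≤ t →
      HasWeakDerivs (u t) (u' t) ∧ HasDerivAt u (A (u' t) + N (u t)) t ∧
      ‖WithLp.toLp 2 (u t, u' t)‖ ≤ ‖WithLp.toLp 2 (u₀, u₀')‖ * Real.exp (k * t) := by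
  obtain ⟨y, hy0, hyc, hy⟩ := exists_global_ode (F := fun t y => S (-t) (N (S t y)))
    (hS.lipschitzWith_conj hN.lipschitz) (hS.continuous_conj hN.lipschitz)
    (fun t => by simp [hN.zero]) u₀
  set M := ‖WithLp.toLp 2 (u₀, u₀')‖
  have hq : ∀ h x t, ‖withQuotient h (S (-t) (N (S t x)))‖ ≤ k * ‖withQuotient h x‖ := by
    intro h x t
    rw [hS.norm_withQuotient]
    exact (hN.quotient h _).trans (by rw [hS.norm_withQuotient])
  -- For fixed h the quotient map is linear and bounded, so it commutes with the time derivative;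
  -- tameness makes the Gronwall bound uniform in h.
  have hgrow : ∀ h t, 0 ≤ t → ‖withQuotient h (y t)‖ ≤ M * Real.exp (k * t) := by
    intro h t ht
    have h1 := norm_le_gronwallBound_of_norm_deriv_right_le
      (f := fun t => withQuotient h (y t))
      (f' := fun t => withQuotient h (S (-t) (N (S t (y t))))) (δ := M) (K := k) (ε := 0)
      (a := 0) (b := t) ((withQuotient h).continuous.comp hyc).continuousOn
      (fun s hs => ((withQuotient h).hasFDerivAt.comp_hasDerivAt s
        (hy s hs.1)).hasDerivWithinAt)
      (by simpa [hy0] using h₀.norm_withQuotient_le h)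
      (fun s _ => by rw [add_zero]; exact hq h (y s) s) t ⟨ht, le_rfl⟩
    rwa [gronwallBound_ε0, sub_zero] at h1
  have hex : ∀ t, ∃ y', 0 ≤ t → HasWeakDerivs (y t) y' ∧
      ‖WithLp.toLp 2 (y t, y')‖ ≤ M * Real.exp (k * t) := by
    intro t
    by_cases ht : 0 ≤ t
    · obtain ⟨y', h1, h2⟩ := exists_hasWeakDerivs_of_norm_withQuotient_le
        fun h _ => hgrow h t ht
      exact ⟨y', fun _ => ⟨h1, h2⟩⟩
    · exact ⟨0, fun h => absurd h ht⟩
  choose y' hy' using hex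
  -- N need not be differentiable, so no equation for y' is available. The mean value inequality for
  -- the quotients of y, uniform in h, shows instead that y' is Lipschitz in time on bounded
  -- intervals.
  have hdist : ∀ b, ∀ s ∈ Icc 0 b, ∀ t ∈ Icc 0 b,
      ‖y' t - y' s‖ ≤ k * (M * Real.exp (k * b)) * ‖t - s‖ := by
    intro b s hs t ht
    have h1 : ∀ h, h ≠ 0 → ‖withQuotient h (y t - y s)‖ ≤ k * (M * Real.exp (k * b)) * ‖t - s‖ := by
      intro h _
      rw [map_sub]
      refine (convex_Icc 0 b).norm_image_sub_le_of_norm_hasDerivWithin_le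
        (f := fun t => withQuotient h (y t))
        (f' := fun t => withQuotient h (S (-t) (N (S t (y t)))))
        (fun τ hτ => ((withQuotient h).hasFDerivAt.comp_hasDerivAt τ
          (hy τ hτ.1)).hasDerivWithinAt) (fun τ hτ => ?_) hs ht
      refine (hq h _ τ).trans ?_
      have := hgrow h τ hτ.1
      have h2 : (k : ℝ) * τ ≤ k * b := by have := hτ.2; gcongr
      have h3 : M * Real.exp (k * τ) ≤ M * Real.exp (k * b) := by gcongr
      gcongr
      exact this.trans h3
    obtain ⟨w, hw, hwn⟩ := exists_hasWeakDerivs_of_norm_withQuotient_le h1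
    rw [((hy' t ht.1).1.sub (hy' s hs.1).1).unique hw]
    refine le_trans ?_ hwn
    rw [WithLp.prod_norm_eq_of_L2]
    exact Real.le_sqrt_of_sq_le (by simp)
  have hcont : ContinuousOn y' (Ici 0) := by
    intro t ht
    have hl : LipschitzOnWith (k * (M * Real.exp (k * (t + 1)))).toNNReal y' (Icc 0 (t + 1)) := by
      refine LipschitzOnWith.of_dist_le_mul fun a ha b hb => ?_
      rw [dist_eq_norm, dist_eq_norm, Real.coe_toNNReal _ (by positivity)]
      exact hdist _ b hb a ha
    have ht' : t ∈ Icc 0 (t + 1) := ⟨ht, by linarith⟩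
    refine (hl.continuousOn t ht').mono_of_mem_nhdsWithin ?_
    rw [mem_nhdsWithin]
    exact ⟨Iio (t + 1), isOpen_Iio, by simp, fun s hs => ⟨hs.2, le_of_lt hs.1⟩⟩
  refine ⟨fun t => S t (y t), fun t => S t (y' t), by simp [hS.zero, hy0],
    hS.continuous_uncurry.comp (continuous_id.prodMk hyc),
    hS.continuous_uncurry.comp_continuousOn (continuous_id.continuousOn.prodMk hcont),
    fun t ht => ⟨hS.weak t _ _ (hy' t ht).1, hS.hasDerivAt_of_conj (hy' t ht).1 (hy t ht), ?_⟩⟩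
  refine le_trans (norm_toLp_le_of_norm_le ?_ ?_) (hy' t ht).2 <;> simp

end IsPropagator

end Semilinear

/-! ### Superposition operators on L². -/

section Nemytskii

variable {ι : Type*} [Fintype ι]

theorem norm_vec_le_sum {F : Type*} [NormedAddCommGroup F] (y : Vec ι F) : ‖y‖ ≤ ∑ j, ‖y j‖ := by
  rw [PiLp.norm_eq_of_L2]
  refine Real.sqrt_le_iff.2 ⟨by positivity, ?_⟩
  rw [sq (∑ j, _), Finset.sum_mul]
  refine Finset.sum_le_sum fun j _ => ?_
  rw [sq]
  gcongr
  exact Finset.single_le_sum (f := fun j => ‖y j‖) (fun _ _ => norm_nonneg _) (Finset.mem_univ j)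

theorem sum_norm_le_card_mul {F : Type*} [NormedAddCommGroup F] (y : Vec ι F) :
    ∑ j, ‖y j‖ ≤ Fintype.card ι * ‖y‖ := by
  refine (Finset.sum_le_sum fun j _ => PiLp.norm_apply_le y j).trans ?_
  simp

theorem norm_L2_le_of_ae_le_sum {F : Type*} [NormedAddCommGroup F] {f : L2 F} {u v : ι → L2 F}
    {a b : ℝ} (ha : 0 ≤ a) (hb : 0 ≤ b)
    (h : ∀ᵐ z, ‖f z‖ ≤ a * ∑ j, ‖u j z‖ + b * ∑ j, ‖v j z‖) :
    ‖f‖ ≤ a * ∑ j, ‖u j‖ + b * ∑ j, ‖v j‖ := by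
  let n : L2 F → L2 ℝ := fun g => (Lp.memLp g).norm.toLp
  have hn : ∀ g : L2 F, ∀ᵐ z, n g z = ‖g z‖ := fun g => MemLp.coeFn_toLp _
  have hnn : ∀ g : L2 F, ‖n g‖ = ‖g‖ := fun g => by
    simp only [n, Lp.norm_toLp, eLpNorm_norm]; rfl
  have hsum : ∀ w : ι → L2 F, ∀ᵐ z, (∑ j, n (w j)) z = ∑ j, ‖w j z‖ := fun w => by
    have h1 : ∀ᵐ z, ∀ j, n (w j) z = ‖w j z‖ := ae_all_iff.2 fun j => hn (w j)
    filter_upwards [Lp.coeFn_finsetSum Finset.univ fun j => n (w j), h1] with z h2 h3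
    rw [h2, Finset.sum_apply]
    exact Finset.sum_congr rfl fun j _ => h3 j
  have key : ‖f‖ ≤ ‖a • (∑ j, n (u j)) + b • ∑ j, n (v j)‖ := by
    refine Lp.norm_le_norm_of_ae_le ?_
    filter_upwards [h, hsum u, hsum v, Lp.coeFn_add (a • (∑ j, n (u j))) (b • ∑ j, n (v j)),
      Lp.coeFn_smul a (∑ j, n (u j)), Lp.coeFn_smul b (∑ j, n (v j))] with z h1 h2 h3 h4 h5 h6
    rw [h4, Pi.add_apply, h5, h6, Pi.smul_apply, Pi.smul_apply, h2, h3, smul_eq_mul, smul_eq_mul]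
    exact h1.trans (le_abs_self _)
  refine key.trans ((norm_add_le _ _).trans ?_)
  rw [norm_smul, norm_smul, Real.norm_of_nonneg ha, Real.norm_of_nonneg hb]
  gcongr <;>
  · refine (norm_sum_le _ _).trans ?_
    simp [hnn]

variable {F : Type*} [NormedAddCommGroup F]

/-- A pointwise nonlinearity `G_i(U, z)`, globally Lipschitz in `U`, vanishing at `U = 0`, and
Lipschitz in `z` with a constant growing linearly in `U`. -/
structure IsTameDensity (G : ι → (ι → F) → ℝ → F) (K C : ℝ≥0) : Prop where
  lip : ∀ i U V z, ‖G i U z - G i V z‖ ≤ K * ∑ j, ‖U j - V j‖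
  trans : ∀ i U z h, ‖G i U (z + h) - G i U z‖ ≤ C * |h| * ∑ j, ‖U j‖
  zero : ∀ i z, G i 0 z = 0

namespace IsTameDensity

variable {G : ι → (ι → F) → ℝ → F} {K C : ℝ≥0}

/-- Joint continuity supplies the measurability of z ↦ G(y(z), z). -/
theorem continuous_uncurry (hG : IsTameDensity G K C) (i : ι) :
    Continuous fun p : (ι → F) × ℝ => G i p.1 p.2 := by
  refine continuous_prod_of_continuous_lipschitzWith (fun p : (ι → F) × ℝ => G i p.1 p.2)
    (K * Fintype.card ι) (fun U => ?_) (fun z => ?_)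
  · refine (LipschitzWith.of_dist_le_mul (K := C * ∑ j, ‖U j‖₊) fun z w => ?_).continuous
    have := hG.trans i U w (z - w)
    rw [add_sub_cancel] at this
    rw [dist_eq_norm, Real.dist_eq]
    push_cast
    linarith
  · refine LipschitzWith.of_dist_le_mul fun U V => ?_
    rw [dist_eq_norm, dist_eq_norm]
    refine (hG.lip i U V z).trans ?_
    push_cast
    rw [mul_assoc]
    gcongr
    refine (Finset.sum_le_sum fun j _ => norm_le_pi_norm (U - V) j).trans ?_
    simp

variable [MeasurableSpace F] [BorelSpace F] [SecondCountableTopology F]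

theorem memLp (hG : IsTameDensity G K C) (y : Vec ι F) (i : ι) :
    MemLp (fun z => G i (fun j => y j z) z) 2 := by
  have hm : AEStronglyMeasurable (fun z => G i (fun j => y j z) z) volume := by
    refine ((hG.continuous_uncurry i).measurable.comp (Measurable.prodMk
      (measurable_pi_iff.2 fun j => ?_) measurable_id)).aestronglyMeasurable
    exact (Lp.stronglyMeasurable (y j)).measurable
  have hs : MemLp (fun z => (K : ℝ) * ∑ j, ‖y j z‖) 2 :=
    (memLp_finsetSum Finset.univ fun j _ => (Lp.memLp (y j)).norm).const_mul _
  refine hs.of_le hm (Eventually.of_forall fun z => ?_)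
  have := hG.lip i (fun j => y j z) 0 z
  rw [hG.zero, sub_zero] at this
  refine (this.trans (le_of_eq ?_)).trans (le_abs_self _)
  simp

/-- The operator `y ↦ G(y(z), z)` on `L²`. -/
def superposition (hG : IsTameDensity G K C) (y : Vec ι F) : Vec ι F :=
  WithLp.toLp 2 fun i => (hG.memLp y i).toLp

theorem coeFn_superposition (hG : IsTameDensity G K C) (y : Vec ι F) (i : ι) :
    ∀ᵐ z, hG.superposition y i z = G i (fun j => y j z) z :=
  (hG.memLp y i).coeFn_toLp

theorem norm_superposition_sub_le (hG : IsTameDensity G K C) (y w : Vec ι F) :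
    ‖hG.superposition y - hG.superposition w‖ ≤ Fintype.card ι ^ 2 * K * ‖y - w‖ := by
  have h1 : ∀ i, ‖(hG.superposition y - hG.superposition w) i‖ ≤ K * (Fintype.card ι * ‖y - w‖) := by
    intro i
    have := norm_L2_le_of_ae_le_sum (f := (hG.superposition y - hG.superposition w) i)
      (u := fun j => (y - w) j) (v := fun j => (y - w) j) K.coe_nonneg le_rfl (by
        have h2 : ∀ᵐ z, ∀ j, (y - w) j z = y j z - w j z :=
          ae_all_iff.2 fun j => Lp.coeFn_sub (y j) (w j)
        filter_upwards [h2, Lp.coeFn_sub (hG.superposition y i) (hG.superposition w i),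
          hG.coeFn_superposition y i, hG.coeFn_superposition w i] with z h2 h3 h4 h5
        have h6 := hG.lip i (fun j => y j z) (fun j => w j z) z
        simp only [h2, zero_mul, add_zero]
        rw [PiLp.sub_apply, h3, Pi.sub_apply, h4, h5]
        exact h6)
    rw [zero_mul, add_zero] at this
    refine this.trans ?_
    gcongr
    exact sum_norm_le_card_mul (y - w)
  refine (norm_vec_le_sum _).trans ((Finset.sum_le_sum fun i _ => h1 i).trans (le_of_eq ?_))
  simp
  ring

theorem superposition_zero (hG : IsTameDensity G K C) : hG.superposition 0 = 0 := by
  refine PiLp.ext fun i => Lp.ext ?_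
  have h1 : ∀ᵐ z : ℝ, ∀ j : ι, (0 : Vec ι F) j z = 0 := ae_all_iff.2 fun j => Lp.coeFn_zero F 2 _
  filter_upwards [hG.coeFn_superposition 0 i, Lp.coeFn_zero F 2 volume, h1] with z h2 h3 h4
  rw [h2, funext h4]
  exact (hG.zero i z).trans h3.symm

end IsTameDensity

theorem IsTameDensity.isTameNonlinearity {F : Type*} [NormedAddCommGroup F]
    [InnerProductSpace ℝ F] [CompleteSpace F] [MeasurableSpace F] [BorelSpace F]
    [SecondCountableTopology F] {G : ι → (ι → F) → ℝ → F} {K C : ℝ≥0} (hG : IsTameDensity G K C) :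
    IsTameNonlinearity hG.superposition (Fintype.card ι ^ 2 * K)
      (Fintype.card ι ^ 2 * (2 * K + C)) where
  lipschitz := LipschitzWith.of_dist_le_mul fun y w => by
    rw [dist_eq_norm, dist_eq_norm]
    simpa using hG.norm_superposition_sub_le y w
  zero := hG.superposition_zero
  quotient h y := by
    obtain ⟨m, hm⟩ : ∃ m : ℝ, m = (Fintype.card ι : ℝ) := ⟨_, rfl⟩
    have hm0 : 0 ≤ m := hm ▸ Nat.cast_nonneg _
    have hcard : ∀ w : Vec ι F, ∑ j, ‖w j‖ ≤ m * ‖w‖ := hm ▸ sum_norm_le_card_mul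
    set d := h⁻¹ • (diagShift 1 h y - y) with hd
    have hfst : ‖y‖ ≤ ‖withQuotient h y‖ := by
      rw [withQuotient_apply, WithLp.prod_norm_eq_of_L2]
      exact Real.le_sqrt_of_sq_le (by simp)
    have hsnd : ‖d‖ ≤ ‖withQuotient h y‖ := by
      rw [withQuotient_apply, WithLp.prod_norm_eq_of_L2]
      exact Real.le_sqrt_of_sq_le (by simp [hd])
    have h1 : ‖hG.superposition y‖ ≤ m ^ 2 * K * ‖y‖ := by
      rw [hm]
      simpa [hG.superposition_zero] using hG.norm_superposition_sub_le y 0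
    have h2 : ∀ i, ‖(h⁻¹ • (diagShift 1 h (hG.superposition y) - hG.superposition y)) i‖
        ≤ K * (m * ‖d‖) + C * (m * ‖y‖) := by
      intro i
      refine (norm_L2_le_of_ae_le_sum (u := fun j => d j) (v := fun j => y j) K.coe_nonneg
        C.coe_nonneg ?_).trans ?_
      · have e1 : ∀ w : Vec ι F, ∀ j, ∀ᵐ z, (h⁻¹ • (diagShift 1 h w - w)) j z
            = h⁻¹ • (w j (z + h) - w j z) := by
          intro w j
          filter_upwards [Lp.coeFn_smul h⁻¹ ((diagShift 1 h w - w) j),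
            Lp.coeFn_sub (diagShift 1 h w j) (w j), coeFn_shift (1 * h) (w j)] with z h1 h2 h3
          rw [one_mul] at h3
          rw [PiLp.smul_apply, h1, Pi.smul_apply, PiLp.sub_apply, h2, Pi.sub_apply,
            diagShift_apply, Pi.one_apply, one_mul, h3]
        have e2 : ∀ᵐ z, ∀ j, d j z = h⁻¹ • (y j (z + h) - y j z) := ae_all_iff.2 fun j => e1 y j
        filter_upwards [e1 (hG.superposition y) i, e2, hG.coeFn_superposition y i,
          ae_comp_add (hG.coeFn_superposition y i) h] with z h3 h4 h5 h6
        rw [h3, h5, h6, norm_smul, norm_inv, Real.norm_eq_abs]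
        simp only [h4, norm_smul, norm_inv, Real.norm_eq_abs, ← Finset.mul_sum]
        -- The increment splits into a change of U at the fixed position z + h, giving K times the
        -- quotient of y, and a change of position at fixed U, giving C|y|.
        have h7 := hG.lip i (fun j => y j (z + h)) (fun j => y j z) (z + h)
        have h8 := hG.trans i (fun j => y j z) z h
        have h9 := (norm_sub_le_norm_sub_add_norm_sub (G i (fun j => y j (z + h)) (z + h))
          (G i (fun j => y j z) (z + h)) (G i (fun j => y j z) z)).trans (add_le_add h7 h8)
        -- An inequality rather than an equality, so that h = 0 is covered.
        have h10 : |h|⁻¹ * |h| ≤ 1 := inv_mul_le_one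
        calc _ ≤ |h|⁻¹ * (K * ∑ j, ‖y j (z + h) - y j z‖ + C * |h| * ∑ j, ‖y j z‖) := by gcongr
          _ = K * (|h|⁻¹ * ∑ j, ‖y j (z + h) - y j z‖) + C * ((|h|⁻¹ * |h|) * ∑ j, ‖y j z‖) := by
            ring
          _ ≤ K * (|h|⁻¹ * ∑ j, ‖y j (z + h) - y j z‖) + C * (1 * ∑ j, ‖y j z‖) := by gcongr
          _ = _ := by ring
      · gcongr <;> exact hcard _
    have h3 : ‖h⁻¹ • (diagShift 1 h (hG.superposition y) - hG.superposition y)‖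
        ≤ m * (K * (m * ‖d‖) + C * (m * ‖y‖)) := by
      refine (norm_vec_le_sum _).trans ((Finset.sum_le_sum fun i _ => h2 i).trans (le_of_eq ?_))
      rw [Finset.sum_const, Finset.card_univ, nsmul_eq_mul, hm]
    have h4 : ‖withQuotient h (hG.superposition y)‖ ≤ ‖hG.superposition y‖ +
        ‖h⁻¹ • (diagShift 1 h (hG.superposition y) - hG.superposition y)‖ := by
      rw [withQuotient_apply, WithLp.prod_norm_eq_of_L2]
      refine Real.sqrt_le_iff.2 ⟨by positivity, ?_⟩
      change ‖hG.superposition y‖ ^ 2 +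
        ‖h⁻¹ • (diagShift 1 h (hG.superposition y) - hG.superposition y)‖ ^ 2 ≤ _
      nlinarith [norm_nonneg (hG.superposition y), norm_nonneg
        (h⁻¹ • (diagShift 1 h (hG.superposition y) - hG.superposition y))]
    -- In the constant 2K + C one K comes from the L² part and the other from the quotient part.
    calc _ ≤ m ^ 2 * K * ‖y‖ + m * (K * (m * ‖d‖) + C * (m * ‖y‖)) := h4.trans (add_le_add h1 h3)
      _ ≤ m ^ 2 * K * ‖withQuotient h y‖ + m * (K * (m * ‖withQuotient h y‖)
          + C * (m * ‖withQuotient h y‖)) := by gcongr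
      _ = _ := by push_cast; rw [hm]; ring

end Nemytskii

/-! ### From L² curves to H¹ solutions; construction of propagators. -/

section Solutions

variable {ι : Type*} [Fintype ι] {F : Type*} [NormedAddCommGroup F] [InnerProductSpace ℝ F]

/-- Vectors of `H¹` functions. -/
abbrev VecH1 (ι F : Type*) [Fintype ι] [NormedAddCommGroup F] [InnerProductSpace ℝ F] : Type _ :=
  PiLp 2 (fun _ : ι => H1 F)

/-- The underlying vector of `L²` functions. -/
def valueVec (u : VecH1 ι F) : Vec ι F := WithLp.toLp 2 fun j => toL2 (u j)

/-- The vector of weak derivatives. -/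
def derivVec (u : VecH1 ι F) : Vec ι F := WithLp.toLp 2 fun j => dz (u j)

@[simp] theorem valueVec_apply (u : VecH1 ι F) (j : ι) : valueVec u j = toL2 (u j) := rfl

theorem hasWeakDerivs_valueVec (u : VecH1 ι F) : HasWeakDerivs (valueVec u) (derivVec u) :=
  fun j => (u j).2

theorem norm_vecH1 (u : VecH1 ι F) : ‖u‖ = ‖WithLp.toLp 2 (valueVec u, derivVec u)‖ := by
  have h1 : ∀ j, ‖u j‖ ^ 2 = ‖valueVec u j‖ ^ 2 + ‖derivVec u j‖ ^ 2 := fun j =>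
    WithLp.prod_norm_sq_eq_of_L2 (u j : WithLp 2 (L2 F × L2 F))
  rw [WithLp.prod_norm_eq_of_L2, PiLp.norm_eq_of_L2]
  change _ = √(‖valueVec u‖ ^ 2 + ‖derivVec u‖ ^ 2)
  rw [PiLp.norm_sq_eq_of_L2, PiLp.norm_sq_eq_of_L2, ← Finset.sum_add_distrib]
  simp only [h1]

theorem valueVec_injective [CompleteSpace F] :
    Function.Injective (valueVec : VecH1 ι F → Vec ι F) := by
  intro u v h
  have h' : derivVec u = derivVec v :=
    (hasWeakDerivs_valueVec u).unique (h ▸ hasWeakDerivs_valueVec v)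
  refine PiLp.ext fun j => Subtype.ext ?_
  have e1 : toL2 (u j) = toL2 (v j) := congrArg (fun w : Vec ι F => w j) h
  have e2 : dz (u j) = dz (v j) := congrArg (fun w : Vec ι F => w j) h'
  exact congrArg (WithLp.toLp 2) (Prod.ext e1 e2)

open Classical in
/-- The element of `H¹` with given values and weak derivatives (and `0` if they do not fit). -/
def mkVecH1 (y y' : Vec ι F) : VecH1 ι F :=
  if h : HasWeakDerivs y y' then WithLp.toLp 2 fun j => ⟨WithLp.toLp 2 (y j, y' j), h.mem j⟩ else 0

theorem valueVec_mkVecH1 {y y' : Vec ι F} (h : HasWeakDerivs y y') :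
    valueVec (mkVecH1 y y') = y := by
  rw [mkVecH1, dif_pos h]; rfl

theorem derivVec_mkVecH1 {y y' : Vec ι F} (h : HasWeakDerivs y y') :
    derivVec (mkVecH1 y y') = y' := by
  rw [mkVecH1, dif_pos h]; rfl

theorem norm_valueVec_le (u : VecH1 ι F) : ‖valueVec u‖ ≤ ‖u‖ := by
  rw [norm_vecH1, WithLp.prod_norm_eq_of_L2]
  exact Real.le_sqrt_of_sq_le (by simp)

theorem valueVec_sub (u v : VecH1 ι F) : valueVec (u - v) = valueVec u - valueVec v := rfl

theorem continuous_valueVec : Continuous (valueVec : VecH1 ι F → Vec ι F) := by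
  refine (LipschitzWith.of_dist_le_mul (K := 1) fun u v => ?_).continuous
  rw [dist_eq_norm, dist_eq_norm, ← valueVec_sub, NNReal.coe_one, one_mul]
  exact norm_valueVec_le _

theorem continuousOn_vecH1 {u : ℝ → VecH1 ι F} {s : Set ℝ}
    (h : ContinuousOn (fun t => valueVec (u t)) s) (h' : ContinuousOn (fun t => derivVec (u t)) s) :
    ContinuousOn u s := by
  intro t ht
  have h1 := (h t ht).sub (continuousWithinAt_const (b := valueVec (u t)))
  have h2 := (h' t ht).sub (continuousWithinAt_const (b := derivVec (u t)))
  refine tendsto_iff_norm_sub_tendsto_zero.2 ?_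
  have h3 : ContinuousWithinAt (fun τ => √(‖valueVec (u τ) - valueVec (u t)‖ ^ 2
      + ‖derivVec (u τ) - derivVec (u t)‖ ^ 2)) s t :=
    ((h1.norm.pow 2).add (h2.norm.pow 2)).sqrt
  have h4 := h3.tendsto
  simp only [sub_self, norm_zero, ne_eq, OfNat.ofNat_ne_zero, not_false_eq_true, zero_pow, add_zero,
    Real.sqrt_zero] at h4
  refine h4.congr fun τ => ?_
  rw [norm_vecH1, WithLp.prod_norm_eq_of_L2]
  rfl

/-- `H¹` solutions on `[0, T)` of `∂_t u = A ∂_z u + N(u)`. -/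
structure IsH1Solution (A : Vec ι F →L[ℝ] Vec ι F) (N : Vec ι F → Vec ι F) (T : EReal)
    (u₀ : VecH1 ι F) (u : ℝ → VecH1 ι F) : Prop where
  continuousOn : ContinuousOn u (timeInterval T)
  initial : u 0 = u₀
  eq : ∀ t ∈ timeInterval T, HasDerivWithinAt (fun s => valueVec (u s))
    (A (derivVec (u t)) + N (valueVec (u t))) (timeInterval T) t

theorem timeInterval_top : timeInterval ⊤ = Ici 0 := by
  ext t; simp [timeInterval, EReal.coe_lt_top]

theorem timeInterval_mono {T T' : EReal} (h : T ≤ T') : timeInterval T ⊆ timeInterval T' :=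
  fun _ ht => ⟨ht.1, ht.2.trans_le h⟩

theorem Icc_subset_timeInterval {T : EReal} {b : ℝ} (hb : (b : EReal) < T) :
    Icc 0 b ⊆ timeInterval T := fun _ ht => ⟨ht.1, (EReal.coe_le_coe_iff.2 ht.2).trans_lt hb⟩

theorem timeInterval_mem_nhdsWithin_Ici {T : EReal} {t : ℝ} (ht : t ∈ timeInterval T) :
    timeInterval T ∈ 𝓝[Ici t] t := by
  rw [mem_nhdsWithin]
  refine ⟨{s : ℝ | (s : EReal) < T}, isOpen_Iio.preimage continuous_coe_real_ereal, ht.2, ?_⟩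
  exact fun s hs => ⟨ht.1.trans hs.2, hs.1⟩

variable {A : Vec ι F →L[ℝ] Vec ι F} {N : Vec ι F → Vec ι F} {S : ℝ → Vec ι F ≃ₗᵢ[ℝ] Vec ι F}
  {K k : ℝ≥0}

theorem IsH1Solution.mono {T T' : EReal} {u₀ : VecH1 ι F} {u : ℝ → VecH1 ι F}
    (h : IsH1Solution A N T u₀ u) (hT : T' ≤ T) : IsH1Solution A N T' u₀ u :=
  ⟨h.continuousOn.mono (timeInterval_mono hT), h.initial, fun t ht =>
    (h.eq t (timeInterval_mono hT ht)).mono (timeInterval_mono hT)⟩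

variable [CompleteSpace F]

theorem IsPropagator.exists_isH1Solution (hS : IsPropagator S A) (hN : IsTameNonlinearity N K k)
    (u₀ : VecH1 ι F) : ∃ u, IsH1Solution A N ⊤ u₀ u ∧
      ∀ t, 0 ≤ t → ‖u t‖ ≤ ‖u₀‖ * Real.exp (k * t) := by
  obtain ⟨y, y', h0, hyc, hyc', h⟩ := hS.exists_solution hN (hasWeakDerivs_valueVec u₀)
  have hv : ∀ t, 0 ≤ t → valueVec (mkVecH1 (y t) (y' t)) = y t := fun t ht =>
    valueVec_mkVecH1 (h t ht).1
  have hd : ∀ t, 0 ≤ t → derivVec (mkVecH1 (y t) (y' t)) = y' t := fun t ht =>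
    derivVec_mkVecH1 (h t ht).1
  refine ⟨fun t => mkVecH1 (y t) (y' t), ⟨?_, ?_, ?_⟩, fun t ht => ?_⟩
  · rw [timeInterval_top]
    exact continuousOn_vecH1 (hyc.continuousOn.congr fun t ht => hv t ht)
      (hyc'.congr fun t ht => hd t ht)
  · exact valueVec_injective ((hv 0 le_rfl).trans h0)
  · rw [timeInterval_top]
    intro t ht
    rw [hv t ht, hd t ht]
    exact (h t ht).2.1.hasDerivWithinAt.congr (fun s hs => hv s hs) (hv t ht)
  · rw [norm_vecH1, hv t ht, hd t ht, norm_vecH1]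
    exact (h t ht).2.2

theorem IsPropagator.eqOn_of_isH1Solution (hS : IsPropagator S A) (hN : LipschitzWith K N)
    {T : EReal} {u₀ : VecH1 ι F} {u v : ℝ → VecH1 ι F} (hu : IsH1Solution A N T u₀ u)
    (hv : IsH1Solution A N T u₀ v) : EqOn u v (timeInterval T) := by
  intro b hb
  have hsub := Icc_subset_timeInterval hb.2
  have key := hS.eqOn_of_hasDerivWithinAt hN (b := b)
    (u := fun t => valueVec (u t)) (u' := fun t => derivVec (u t))
    (v := fun t => valueVec (v t)) (v' := fun t => derivVec (v t))
    (continuous_valueVec.comp_continuousOn (hu.continuousOn.mono hsub))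
    (continuous_valueVec.comp_continuousOn (hv.continuousOn.mono hsub))
    (fun t _ => hasWeakDerivs_valueVec _) (fun t _ => hasWeakDerivs_valueVec _)
    (fun t ht => (hu.eq t (hsub (Ico_subset_Icc_self ht))).mono_of_mem_nhdsWithin
      (timeInterval_mem_nhdsWithin_Ici (hsub (Ico_subset_Icc_self ht))))
    (fun t ht => (hv.eq t (hsub (Ico_subset_Icc_self ht))).mono_of_mem_nhdsWithin
      (timeInterval_mem_nhdsWithin_Ici (hsub (Ico_subset_Icc_self ht))))
    (by simp only [hu.initial, hv.initial])
  exact valueVec_injective (key ⟨hb.1, le_rfl⟩)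

theorem isPropagator_diagShift (c : ι → ℝ) {A : Vec ι F →L[ℝ] Vec ι F}
    (hA : ∀ y j, A y j = c j • y j) : IsPropagator (diagShift c) A := by
  have hA' : ∀ y, A y = WithLp.toLp 2 fun j => c j • y j := fun y => PiLp.ext fun j => hA y j
  refine ⟨fun y => PiLp.ext fun j => by simp, fun a b y => PiLp.ext fun j => ?_,
    continuous_diagShift c, fun t h y => PiLp.ext fun j => ?_, fun t y y' h => h.diagShift c t,
    fun y y' h t => ?_, fun t y => PiLp.ext fun j => ?_⟩
  · simp [shift_shift, mul_add]
  · simp [shift_shift, add_comm]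
  · convert h.hasDerivAt_diagShift c t using 1
    exact PiLp.ext fun j => by simp [hA]
  · simp [hA]

/-- Reduces a coupled generator to its characteristic variables; U is an involution, so it also
undoes the change of variables. -/
theorem IsPropagator.conj (hS : IsPropagator S A) (U : Vec ι F ≃ₗᵢ[ℝ] Vec ι F)
    (hU : ∀ y, U (U y) = y) (hcomm : ∀ h y, U (diagShift 1 h y) = diagShift 1 h (U y))
    (hweak : ∀ y y', HasWeakDerivs y y' → HasWeakDerivs (U y) (U y'))
    {A' : Vec ι F →L[ℝ] Vec ι F} (hA : ∀ y, A' y = U (A (U y))) :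
    IsPropagator (fun t => (U.trans (S t)).trans U) A' where
  zero y := by simp [hS.zero, hU]
  add a b y := by simp [hU, hS.add]
  cont y := U.continuous.comp (hS.cont (U y))
  comm t h y := by simp [hcomm, hS.comm]
  weak t y y' h := hweak _ _ (hS.weak t _ _ (hweak _ _ h))
  deriv y y' h t := by
    have := U.toContinuousLinearEquiv.toContinuousLinearMap.hasFDerivAt.comp_hasDerivAt t
      (hS.deriv _ _ (hweak _ _ h) t)
    convert! this using 1
    simp [hA, hU]
  apply_comm t y := by simp [hA, hU, hS.apply_comm]

end Solutions

/-! ### The anharmonic Maxwell–Lorentz system. -/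

section AMLE

/-- Assemble bounded operators into the components of a vector. -/
def vecCLM {ι F : Type*} [Fintype ι] [NormedAddCommGroup F] [InnerProductSpace ℝ F]
    (f : ι → Vec ι F →L[ℝ] L2 F) : Vec ι F →L[ℝ] Vec ι F :=
  (PiLp.continuousLinearEquiv 2 ℝ fun _ : ι => L2 F).symm.toContinuousLinearMap ∘L
    ContinuousLinearMap.pi f

/-- The rotation diagonalizing the wave operator. -/
def waveRotationₗ : Vec (Fin 4) ℝ →ₗ[ℝ] Vec (Fin 4) ℝ where
  toFun y := WithLp.toLp 2 ![(√2)⁻¹ • (y 0 + y 1), (√2)⁻¹ • (y 0 - y 1), y 2, y 3]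
  map_add' y w := by
    refine PiLp.ext fun j => ?_
    fin_cases j
    · change (√2)⁻¹ • ((y 0 + w 0) + (y 1 + w 1)) = (√2)⁻¹ • (y 0 + y 1) + (√2)⁻¹ • (w 0 + w 1)
      module
    · change (√2)⁻¹ • ((y 0 + w 0) - (y 1 + w 1)) = (√2)⁻¹ • (y 0 - y 1) + (√2)⁻¹ • (w 0 - w 1)
      module
    · rfl
    · rfl
  map_smul' c y := by
    refine PiLp.ext fun j => ?_
    fin_cases j <;> simp [← smul_add, ← smul_sub, smul_comm c]

theorem inv_sqrt_two_sq : (√2)⁻¹ * (√2)⁻¹ = (1 / 2 : ℝ) := by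
  rw [← mul_inv, Real.mul_self_sqrt (by norm_num)]; norm_num

theorem waveRotationₗ_involutive : Function.Involutive waveRotationₗ := by
  intro y
  refine PiLp.ext fun j => ?_
  fin_cases j
  · change (√2)⁻¹ • ((√2)⁻¹ • (y 0 + y 1) + (√2)⁻¹ • (y 0 - y 1)) = y 0
    rw [← smul_add, smul_smul, inv_sqrt_two_sq]; module
  · change (√2)⁻¹ • ((√2)⁻¹ • (y 0 + y 1) - (√2)⁻¹ • (y 0 - y 1)) = y 1
    rw [← smul_sub, smul_smul, inv_sqrt_two_sq]; module
  · rfl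
  · rfl

/-- The rotation diagonalizing the wave operator, as an isometry. -/
def waveRotation : Vec (Fin 4) ℝ ≃ₗᵢ[ℝ] Vec (Fin 4) ℝ where
  toLinearEquiv := LinearEquiv.ofInvolutive waveRotationₗ waveRotationₗ_involutive
  norm_map' y := by
    change ‖waveRotationₗ y‖ = ‖y‖
    rw [PiLp.norm_eq_of_L2, PiLp.norm_eq_of_L2]
    simp only [Fin.sum_univ_four]
    change √(‖(√2)⁻¹ • (y 0 + y 1)‖ ^ 2 + ‖(√2)⁻¹ • (y 0 - y 1)‖ ^ 2 + ‖y 2‖ ^ 2 + ‖y 3‖ ^ 2) = _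
    have h := parallelogram_law_with_norm ℝ (y 0) (y 1)
    rw [norm_smul, norm_smul, mul_pow, mul_pow, Real.norm_eq_abs, sq_abs, sq (√2)⁻¹,
      inv_sqrt_two_sq]
    congr 1
    linarith

theorem waveRotation_apply (y : Vec (Fin 4) ℝ) : waveRotation y =
    WithLp.toLp 2 ![(√2)⁻¹ • (y 0 + y 1), (√2)⁻¹ • (y 0 - y 1), y 2, y 3] := rfl

/-- The first order part of the anharmonic Maxwell-Lorentz system. -/
def amleGenerator : Vec (Fin 4) ℝ →L[ℝ] Vec (Fin 4) ℝ :=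
  vecCLM ![PiLp.proj 2 _ 1, PiLp.proj 2 _ 0, 0, 0]

/-- The characteristic variables are (E + B)/√2 and (E - B)/√2, transported with coefficients 1 and
-1; P and Q are not transported. -/
theorem exists_isPropagator_amleGenerator : ∃ S, IsPropagator S amleGenerator := by
  let c : Fin 4 → ℝ := ![1, -1, 0, 0]
  have h := isPropagator_diagShift (F := ℝ) c
    (A := vecCLM fun j => c j • PiLp.proj 2 _ j) (fun y j => rfl)
  refine ⟨_, h.conj waveRotation waveRotationₗ_involutive (fun h y => ?_) (fun y y' hy => ?_)
    fun y => ?_⟩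
  · refine PiLp.ext fun j => ?_
    fin_cases j <;> simp [waveRotation_apply]
  · intro j
    have h0 := hy.mem 0
    have h1 := hy.mem 1
    fin_cases j
    · exact (H1 ℝ).smul_mem (√2)⁻¹ ((H1 ℝ).add_mem h0 h1)
    · exact (H1 ℝ).smul_mem (√2)⁻¹ ((H1 ℝ).sub_mem h0 h1)
    · exact hy 2
    · exact hy 3
  · refine PiLp.ext fun j => ?_
    fin_cases j
    · change y 1 = (√2)⁻¹ • ((1 : ℝ) • (√2)⁻¹ • (y 0 + y 1) + (-1 : ℝ) • (√2)⁻¹ • (y 0 - y 1))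
      have : (1 : ℝ) • (√2)⁻¹ • (y 0 + y 1) + (-1 : ℝ) • (√2)⁻¹ • (y 0 - y 1)
          = (√2)⁻¹ • ((2 : ℝ) • y 1) := by module
      rw [this, smul_smul, inv_sqrt_two_sq]; module
    · change y 0 = (√2)⁻¹ • ((1 : ℝ) • (√2)⁻¹ • (y 0 + y 1) - (-1 : ℝ) • (√2)⁻¹ • (y 0 - y 1))
      have : (1 : ℝ) • (√2)⁻¹ • (y 0 + y 1) - (-1 : ℝ) • (√2)⁻¹ • (y 0 - y 1)
          = (√2)⁻¹ • ((2 : ℝ) • y 0) := by module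
      rw [this, smul_smul, inv_sqrt_two_sq]; module
    · change (0 : L2 ℝ) = (0 : ℝ) • y 2
      simp
    · change (0 : L2 ℝ) = (0 : ℝ) • y 3
      simp

/-- The zeroth order part of the anharmonic Maxwell-Lorentz system. -/
def amleDensity (ω₀ n ε ν k_B : ℝ) (g : ℝ → ℝ → ℝ) : Fin 4 → (Fin 4 → ℝ) → ℝ → ℝ :=
  ![fun U _ => -U 3, fun _ _ => 0, fun U _ => U 3, fun U z =>
    -ω₀ ^ 2 * (1 - 2 * ε * ν * Real.cos (2 * k_B * z)) * U 2 - ω₀ ^ 2 * g (U 2) z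
      + ω₀ ^ 2 * (n ^ 2 - 1) * U 0]

/-- The bound C|P| forces g to vanish at P = 0; the other two bounds are mean value inequalities in
P and in z. -/
theorem HypothesisN1.exists_bounds {g : ℝ → ℝ → ℝ} (hg : HypothesisN1 g) :
    ∃ C : ℝ, 0 ≤ C ∧ (∀ z, g 0 z = 0) ∧ (∀ P P' z, |g P z - g P' z| ≤ C * |P - P'|) ∧
      ∀ P z h, |g P (z + h) - g P z| ≤ C * |h| * |P| := by
  obtain ⟨C, hC⟩ := hg
  have hC0 : 0 ≤ C := (abs_nonneg _).trans (hC 0 0).2.2.2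
  refine ⟨C, hC0, fun z => ?_, fun P P' z => ?_, fun P z h => ?_⟩
  · have := (hC 0 z).2.2.1
    rw [abs_zero, mul_zero] at this
    exact abs_eq_zero.1 (le_antisymm (by linarith [abs_nonneg (deriv (fun y => g 0 y) z)])
      (abs_nonneg _))
  · exact convex_univ.norm_image_sub_le_of_norm_deriv_le (f := fun p => g p z)
      (fun p _ => (hC p z).1) (fun p _ => (hC p z).2.2.2) (mem_univ P') (mem_univ P)
  · have := convex_univ.norm_image_sub_le_of_norm_deriv_le (f := fun y => g P y) (C := C * |P|)
      (fun y _ => (hC P y).2.1)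
      (fun y _ => (le_add_of_nonneg_left (abs_nonneg _)).trans (hC P y).2.2.1)
      (mem_univ z) (mem_univ (z + h))
    rw [add_sub_cancel_left, Real.norm_eq_abs, Real.norm_eq_abs] at this
    linarith

theorem isTameDensity_amleDensity (ω₀ n ε ν k_B : ℝ) {g : ℝ → ℝ → ℝ} (hg : HypothesisN1 g) :
    ∃ K C, IsTameDensity (amleDensity ω₀ n ε ν k_B g) K C := by
  obtain ⟨C, hC0, hz, hP, hh⟩ := hg.exists_bounds
  have hcos : ∀ z, |1 - 2 * ε * ν * Real.cos (2 * k_B * z)| ≤ 1 + 2 * |ε * ν| := fun z => by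
    have h1 : |2 * (ε * ν) * Real.cos (2 * k_B * z)| ≤ 2 * |ε * ν| * 1 := by
      rw [abs_mul, abs_mul, abs_two]
      gcongr
      exact Real.abs_cos_le_one _
    rw [abs_le] at h1 ⊢
    constructor <;> nlinarith [abs_nonneg (ε * ν)]
  have hcos' : ∀ z h, |Real.cos (2 * k_B * (z + h)) - Real.cos (2 * k_B * z)|
      ≤ 2 * |k_B| * |h| := fun z h => by
    refine (Real.abs_cos_sub_cos_le _ _).trans (le_of_eq ?_)
    rw [← mul_sub, add_sub_cancel_left, abs_mul, abs_mul, abs_two]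
  -- The summand 1 pays for the entries ±Q, the others for the three terms of the Q equation. In
  -- `C'` only the cosine and g contribute, as only they depend on z.
  let K : ℝ≥0 := ⟨1 + ω₀ ^ 2 * (1 + 2 * |ε * ν|) + ω₀ ^ 2 * C + ω₀ ^ 2 * |n ^ 2 - 1|, by positivity⟩
  let C' : ℝ≥0 := ⟨ω₀ ^ 2 * (2 * |ε * ν| * (2 * |k_B|)) + ω₀ ^ 2 * C, by positivity⟩
  have hK : (K : ℝ) = 1 + ω₀ ^ 2 * (1 + 2 * |ε * ν|) + ω₀ ^ 2 * C + ω₀ ^ 2 * |n ^ 2 - 1| := rfl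
  have hC' : (C' : ℝ) = ω₀ ^ 2 * (2 * |ε * ν| * (2 * |k_B|)) + ω₀ ^ 2 * C := rfl
  have hK1 : 1 ≤ (K : ℝ) := by
    rw [hK]
    have h1 : 0 ≤ ω₀ ^ 2 * (1 + 2 * |ε * ν|) := by positivity
    have h2 : 0 ≤ ω₀ ^ 2 * C := by positivity
    have h3 : 0 ≤ ω₀ ^ 2 * |n ^ 2 - 1| := by positivity
    linarith
  have hsingle : ∀ (V : Fin 4 → ℝ) (j : Fin 4), |V j| ≤ ∑ i, ‖V i‖ := fun V j =>
    Finset.single_le_sum (f := fun i => ‖V i‖) (fun _ _ => norm_nonneg _) (Finset.mem_univ j)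
  refine ⟨K, C', fun i U V z => ?_, fun i U z h => ?_, fun i z => ?_⟩
  · have h3 := hsingle (U - V) 3
    have hs : 0 ≤ ∑ i, ‖U i - V i‖ := by positivity
    have h3' : |U 3 - V 3| ≤ K * ∑ i, ‖U i - V i‖ := h3.trans (le_mul_of_one_le_left hs hK1)
    fin_cases i
    · change ‖-U 3 - -V 3‖ ≤ _
      rw [Real.norm_eq_abs, neg_sub_neg, abs_sub_comm]
      exact h3'
    · change ‖(0 : ℝ) - 0‖ ≤ _
      rw [sub_zero, norm_zero]
      positivity
    · exact h3'
    · have h0 : |U 0 - V 0| ≤ ∑ i, ‖U i - V i‖ := hsingle (U - V) 0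
      have h2 : |U 2 - V 2| ≤ ∑ i, ‖U i - V i‖ := hsingle (U - V) 2
      have e : amleDensity ω₀ n ε ν k_B g 3 U z - amleDensity ω₀ n ε ν k_B g 3 V z
          = -(ω₀ ^ 2 * ((1 - 2 * ε * ν * Real.cos (2 * k_B * z)) * (U 2 - V 2)))
            - ω₀ ^ 2 * (g (U 2) z - g (V 2) z) + ω₀ ^ 2 * ((n ^ 2 - 1) * (U 0 - V 0)) := by
        simp only [amleDensity, Matrix.cons_val]
        ring
      change ‖amleDensity ω₀ n ε ν k_B g 3 U z - amleDensity ω₀ n ε ν k_B g 3 V z‖ ≤ _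
      rw [e, Real.norm_eq_abs]
      refine ((abs_add_le _ _).trans (add_le_add_left (abs_sub _ _) _)).trans ?_
      rw [abs_neg, abs_mul, abs_mul, abs_mul, abs_mul (ω₀ ^ 2), abs_mul (n ^ 2 - 1),
        abs_of_nonneg (sq_nonneg ω₀)]
      calc _ ≤ ω₀ ^ 2 * ((1 + 2 * |ε * ν|) * ∑ i, ‖U i - V i‖)
            + ω₀ ^ 2 * (C * ∑ i, ‖U i - V i‖) + ω₀ ^ 2 * (|n ^ 2 - 1| * ∑ i, ‖U i - V i‖) := by
            gcongr
            · exact hcos z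
            · exact (hP _ _ _).trans (by gcongr)
        _ ≤ K * ∑ i, ‖U i - V i‖ := by rw [hK]; nlinarith
  · fin_cases i
    · change ‖-U 3 - -U 3‖ ≤ _
      rw [sub_self, norm_zero]; positivity
    · change ‖(0 : ℝ) - 0‖ ≤ _
      rw [sub_zero, norm_zero]; positivity
    · change ‖U 3 - U 3‖ ≤ _
      rw [sub_self, norm_zero]; positivity
    · have e : amleDensity ω₀ n ε ν k_B g 3 U (z + h) - amleDensity ω₀ n ε ν k_B g 3 U z
          = ω₀ ^ 2 * (2 * (ε * ν) * (Real.cos (2 * k_B * (z + h)) - Real.cos (2 * k_B * z)) * U 2)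
            - ω₀ ^ 2 * (g (U 2) (z + h) - g (U 2) z) := by
        simp only [amleDensity, Matrix.cons_val]
        ring
      change ‖amleDensity ω₀ n ε ν k_B g 3 U (z + h) - amleDensity ω₀ n ε ν k_B g 3 U z‖ ≤ _
      rw [e, Real.norm_eq_abs]
      refine (abs_sub _ _).trans ?_
      have h2 := hsingle U 2
      rw [abs_mul, abs_mul, abs_mul, abs_mul, abs_mul (ω₀ ^ 2),
        abs_of_nonneg (sq_nonneg ω₀), abs_two]
      calc _ ≤ ω₀ ^ 2 * (2 * |ε * ν| * (2 * |k_B| * |h|) * ∑ i, ‖U i‖)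
            + ω₀ ^ 2 * (C * |h| * ∑ i, ‖U i‖) := by
            gcongr
            · exact hcos' z h
            · exact (hh _ _ _).trans (by gcongr)
        _ = _ := by rw [hC']; ring
  · fin_cases i <;> simp [amleDensity, hz]

theorem isAMLESolution_iff {ω₀ n ε ν k_B : ℝ} {g : ℝ → ℝ → ℝ} {K C : ℝ≥0}
    (hG : IsTameDensity (amleDensity ω₀ n ε ν k_B g) K C) {T : EReal} {u₀ : AMLEState}
    {u : ℝ → AMLEState} :
    IsAMLESolution ω₀ n ε ν k_B g T u₀ u ↔ IsH1Solution amleGenerator hG.superposition T u₀ u := by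
  have e0 : ∀ v : AMLEState, hG.superposition (valueVec v) 0 = -toL2 (v 3) := fun v => by
    refine Lp.ext ?_
    filter_upwards [hG.coeFn_superposition (valueVec v) 0, Lp.coeFn_neg (toL2 (v 3))] with z h1 h2
    rw [h1, h2]; rfl
  have e1 : ∀ v : AMLEState, hG.superposition (valueVec v) 1 = 0 := fun v => by
    refine Lp.ext ?_
    filter_upwards [hG.coeFn_superposition (valueVec v) 1, Lp.coeFn_zero ℝ 2 volume] with z h1 h2
    rw [h1, h2]; rfl
  have e2 : ∀ v : AMLEState, hG.superposition (valueVec v) 2 = toL2 (v 3) := fun v => by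
    refine Lp.ext ?_
    filter_upwards [hG.coeFn_superposition (valueVec v) 2] with z h1
    rw [h1]; rfl
  have f0 : ∀ v : AMLEState, (amleGenerator (derivVec v) + hG.superposition (valueVec v)) 0
      = dz (v 1) - toL2 (v 3) := fun v => by
    rw [PiLp.add_apply, e0, sub_eq_add_neg]; rfl
  have f1 : ∀ v : AMLEState, (amleGenerator (derivVec v) + hG.superposition (valueVec v)) 1
      = dz (v 0) := fun v => by
    rw [PiLp.add_apply, e1, add_zero]; rfl
  have f2 : ∀ v : AMLEState, (amleGenerator (derivVec v) + hG.superposition (valueVec v)) 2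
      = toL2 (v 3) := fun v => by
    rw [PiLp.add_apply, e2]; exact zero_add _
  have f3 : ∀ v : AMLEState, (amleGenerator (derivVec v) + hG.superposition (valueVec v)) 3
      = hG.superposition (valueVec v) 3 := fun v => zero_add _
  constructor
  · intro h
    refine ⟨h.continuousOn, h.initial, fun t ht => hasDerivWithinAt_vec.2 fun j => ?_⟩
    fin_cases j
    · exact (f0 (u t)).symm ▸ h.eq_E t ht
    · exact (f1 (u t)).symm ▸ h.eq_B t ht
    · exact (f2 (u t)).symm ▸ h.eq_P t ht
    · obtain ⟨D, hD, hDz⟩ := h.eq_Q t ht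
      have : D = hG.superposition (valueVec (u t)) 3 := by
        refine Lp.ext ?_
        filter_upwards [hDz, hG.coeFn_superposition (valueVec (u t)) 3] with z h1 h2
        rw [h1, h2]; rfl
      exact ((f3 (u t)).trans this.symm).symm ▸ hD
  · intro h
    refine ⟨h.continuousOn, h.initial, fun t ht => ?_, fun t ht => ?_, fun t ht => ?_,
      fun t ht => ⟨hG.superposition (valueVec (u t)) 3, ?_, ?_⟩⟩
    · exact f0 (u t) ▸ hasDerivWithinAt_vec.1 (h.eq t ht) 0
    · exact f1 (u t) ▸ hasDerivWithinAt_vec.1 (h.eq t ht) 1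
    · exact f2 (u t) ▸ hasDerivWithinAt_vec.1 (h.eq t ht) 2
    · exact f3 (u t) ▸ hasDerivWithinAt_vec.1 (h.eq t ht) 3
    · filter_upwards [hG.coeFn_superposition (valueVec (u t)) 3] with z h2
      rw [h2]; rfl

theorem amle_global_wellposedness (ω₀ n ε ν k_B : ℝ) (g : ℝ → ℝ → ℝ) (hg : HypothesisN1 g) :
    ∃ C : ℝ, 0 < C ∧ ∀ u₀ : AMLEState, amleTmax ω₀ n ε ν k_B g u₀ = ⊤ ∧
      ∃ u : ℝ → AMLEState, IsAMLESolution ω₀ n ε ν k_B g ⊤ u₀ u ∧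
        (∀ (T : EReal) (v : ℝ → AMLEState), IsAMLESolution ω₀ n ε ν k_B g T u₀ v →
          EqOn v u (timeInterval T)) ∧
        ∀ t : ℝ, 0 ≤ t → ‖u t‖ ≤ ‖u₀‖ * Real.exp (C * t) := by
  obtain ⟨K, C, hG⟩ := isTameDensity_amleDensity ω₀ n ε ν k_B hg
  obtain ⟨S, hS⟩ := exists_isPropagator_amleGenerator
  obtain ⟨K', k', hN⟩ : ∃ K' k', IsTameNonlinearity hG.superposition K' k' :=
    ⟨_, _, hG.isTameNonlinearity⟩
  -- The + 1 serves only to make the constant strictly positive.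
  refine ⟨k' + 1, by positivity, fun u₀ => ?_⟩
  obtain ⟨u, hu, hb⟩ := hS.exists_isH1Solution hN u₀
  have hu' := (isAMLESolution_iff hG).2 hu
  refine ⟨top_le_iff.1 (le_sSup ⟨le_top, u, hu'⟩), u, hu', fun T v hv => ?_, fun t ht => ?_⟩
  · exact hS.eqOn_of_isH1Solution hN.lipschitz ((isAMLESolution_iff hG).1 hv) (hu.mono le_top)
  · refine (hb t ht).trans ?_
    gcongr
    linarith

end AMLE

/-! ### Coupled mode equations: truncation and the L^∞ bound. -/

section NLCME

/-- The coefficient `|x|² + 2|y|²`, truncated at level `l²`. -/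
def truncCoeff (l : ℝ) (x y : ℂ) : ℝ := min (‖x‖ ^ 2 + 2 * ‖y‖ ^ 2) (l ^ 2)

theorem truncCoeff_nonneg (l : ℝ) (x y : ℂ) : 0 ≤ truncCoeff l x y :=
  le_min (by positivity) (sq_nonneg l)

theorem truncCoeff_le (l : ℝ) (x y : ℂ) : truncCoeff l x y ≤ l ^ 2 := min_le_right _ _

theorem truncCoeff_eq {l M : ℝ} {x y : ℂ} (hM : 3 * M ^ 2 ≤ l ^ 2) (hx : ‖x‖ ≤ M) (hy : ‖y‖ ≤ M) :
    truncCoeff l x y = ‖x‖ ^ 2 + 2 * ‖y‖ ^ 2 := by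
  refine min_eq_left ?_
  nlinarith [norm_nonneg x, norm_nonneg y]

/-- The larger coefficient, at most l², multiplies x - x'; the difference of coefficients multiplies
the x belonging to the smaller one. Either both coefficients are saturated and that difference
vanishes, or |x|, |y| ≤ l and it is at most 9lδ. Hence 10 = 1 + 9. -/
theorem norm_truncCoeff_mul_sub_le {l : ℝ} (hl : 0 ≤ l) (x y x' y' : ℂ) :
    ‖(truncCoeff l x y : ℂ) * x - truncCoeff l x' y' * x'‖
      ≤ 10 * l ^ 2 * (‖x - x'‖ + ‖y - y'‖) := by
  wlog hq : ‖x‖ ^ 2 + 2 * ‖y‖ ^ 2 ≤ ‖x'‖ ^ 2 + 2 * ‖y'‖ ^ 2 generalizing x y x' y'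
  · have := this x' y' x y (le_of_not_ge hq)
    rwa [norm_sub_rev, norm_sub_rev x', norm_sub_rev y'] at this
  set δ := ‖x - x'‖ + ‖y - y'‖ with hδ
  have hx : ‖x - x'‖ ≤ δ := le_add_of_nonneg_right (norm_nonneg _)
  have hy : ‖y - y'‖ ≤ δ := le_add_of_nonneg_left (norm_nonneg _)
  have hδ0 : 0 ≤ δ := by positivity
  have hmono : truncCoeff l x y ≤ truncCoeff l x' y' := min_le_min_right _ hq
  have e : (truncCoeff l x y : ℂ) * x - truncCoeff l x' y' * x'
      = truncCoeff l x' y' * (x - x') - ((truncCoeff l x' y' - truncCoeff l x y : ℝ) : ℂ) * x := by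
    push_cast; ring
  have hb : ‖(truncCoeff l x y : ℂ) * x - truncCoeff l x' y' * x'‖
      ≤ l ^ 2 * δ + (truncCoeff l x' y' - truncCoeff l x y) * ‖x‖ := by
    rw [e]
    refine (norm_sub_le _ _).trans ?_
    rw [norm_mul, norm_mul, Complex.norm_of_nonneg (truncCoeff_nonneg _ _ _),
      Complex.norm_of_nonneg (sub_nonneg.2 hmono)]
    gcongr
    exact truncCoeff_le _ _ _
  refine hb.trans ?_
  rcases le_or_gt (l ^ 2) (‖x‖ ^ 2 + 2 * ‖y‖ ^ 2) with h | h
  · have h1 : truncCoeff l x y = l ^ 2 := min_eq_right h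
    have h2 : truncCoeff l x' y' = l ^ 2 := min_eq_right (h.trans hq)
    rw [h1, h2, sub_self, zero_mul, add_zero]
    have : 0 ≤ l ^ 2 * δ := by positivity
    linarith
  · have hxl : ‖x‖ ≤ l := abs_le_of_sq_le_sq' (by nlinarith [sq_nonneg ‖y‖]) hl |>.2
    have hyl : ‖y‖ ≤ l := abs_le_of_sq_le_sq' (by nlinarith [sq_nonneg ‖x‖, sq_nonneg ‖y‖]) hl |>.2
    have hd : truncCoeff l x' y' - truncCoeff l x y ≤ 9 * l * δ := by
      have h1 : truncCoeff l x y = ‖x‖ ^ 2 + 2 * ‖y‖ ^ 2 := min_eq_left h.le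
      -- For l ≤ δ the crude bound l² ≤ lδ is enough; otherwise expanding the squares gives 3(2lδ +
      -- δ²) ≤ 9lδ.
      rcases le_or_gt l δ with h2 | h2
      · have := truncCoeff_le l x' y'
        have := truncCoeff_nonneg l x y
        nlinarith
      · have h3 : truncCoeff l x' y' ≤ ‖x'‖ ^ 2 + 2 * ‖y'‖ ^ 2 := min_le_left _ _
        have h4 : ‖x'‖ ≤ ‖x‖ + δ := by
          have := norm_le_norm_add_norm_sub x x'
          linarith
        have h5 : ‖y'‖ ≤ ‖y‖ + δ := by
          have := norm_le_norm_add_norm_sub y y'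
          linarith
        have h6 : ‖x'‖ ^ 2 ≤ (‖x‖ + δ) ^ 2 := by gcongr
        have h7 : ‖y'‖ ^ 2 ≤ (‖y‖ + δ) ^ 2 := by gcongr
        have h8 : δ * ‖x‖ ≤ δ * l := by gcongr
        have h9 : δ * ‖y‖ ≤ δ * l := by gcongr
        have h10 : δ * δ ≤ δ * l := by gcongr
        nlinarith
    have h11 : (truncCoeff l x' y' - truncCoeff l x y) * ‖x‖ ≤ 9 * l * δ * l := by gcongr
    linarith

/-- Zeroth order part of one of the coupled mode equations, with truncated nonlinearity. -/
def cmeTerm (κ Γ l : ℝ) (x y : ℂ) : ℂ :=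
  Complex.I * (κ * y) + Complex.I * (Γ * (truncCoeff l x y * x))

theorem norm_cmeTerm_sub_le (κ Γ : ℝ) {l : ℝ} (hl : 0 ≤ l) (x y x' y' : ℂ) :
    ‖cmeTerm κ Γ l x y - cmeTerm κ Γ l x' y'‖
      ≤ (|κ| + 10 * |Γ| * l ^ 2) * (‖x - x'‖ + ‖y - y'‖) := by
  have e : cmeTerm κ Γ l x y - cmeTerm κ Γ l x' y' = Complex.I * (κ * (y - y'))
      + Complex.I * (Γ * (truncCoeff l x y * x - truncCoeff l x' y' * x')) := by
    simp only [cmeTerm]; ring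
  rw [e]
  refine (norm_add_le _ _).trans ?_
  simp only [norm_mul, Complex.norm_I, one_mul, Complex.norm_real, Real.norm_eq_abs]
  have h := norm_truncCoeff_mul_sub_le hl x y x' y'
  calc _ ≤ |κ| * (‖x - x'‖ + ‖y - y'‖) + |Γ| * (10 * l ^ 2 * (‖x - x'‖ + ‖y - y'‖)) := by
        gcongr
        exact le_add_of_nonneg_left (norm_nonneg _)
    _ = _ := by ring

/-- The truncated term multiplies x by 1 + ihθ with θ real, whose modulus √(1 + h²θ²) is at most 1 +
h for small h. This discretization error is the source of the + 1 in the rate |κ| + 1. -/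
theorem norm_add_smul_cmeTerm_le {κ Γ l s h : ℝ} {x y : ℂ} (hx : ‖x‖ ≤ s) (hy : ‖y‖ ≤ s)
    (hh : 0 < h) (hh' : h * (|Γ| * l ^ 2) ^ 2 ≤ 1) :
    ‖x + h • cmeTerm κ Γ l x y‖ ≤ s + h * ((|κ| + 1) * s) := by
  set θ : ℝ := Γ * truncCoeff l x y with hθ
  have hs : 0 ≤ s := (norm_nonneg _).trans hx
  have hθ' : θ ^ 2 ≤ (|Γ| * l ^ 2) ^ 2 := by
    rw [hθ, mul_pow, mul_pow, sq_abs]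
    have := truncCoeff_le l x y
    have := truncCoeff_nonneg l x y
    gcongr
  have e : x + h • cmeTerm κ Γ l x y = (1 + (h * θ : ℝ) * Complex.I) * x
      + Complex.I * ((h * κ : ℝ) * y) := by
    simp only [cmeTerm, hθ, Complex.real_smul]; push_cast; ring
  have h1 : ‖(1 + (h * θ : ℝ) * Complex.I : ℂ)‖ ≤ 1 + h := by
    have : (1 + (h * θ : ℝ) * Complex.I : ℂ) = ((1 : ℝ) : ℂ) + (h * θ : ℝ) * Complex.I := by simp
    rw [this, Complex.norm_add_mul_I]
    refine Real.sqrt_le_iff.2 ⟨by positivity, ?_⟩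
    have : h * (h * θ ^ 2) ≤ h * 1 := by
      gcongr
      exact le_trans (by gcongr) hh'
    nlinarith
  rw [e]
  refine (norm_add_le _ _).trans ?_
  rw [norm_mul, norm_mul, norm_mul, Complex.norm_I, one_mul, Complex.norm_real, Real.norm_eq_abs,
    abs_mul, abs_of_pos hh]
  calc _ ≤ (1 + h) * s + h * |κ| * s := by gcongr
    _ = _ := by ring

/-- Zeroth order part of the coupled mode equations, with truncated nonlinearity. -/
def cmeDensity (κ Γ l : ℝ) : Fin 2 → (Fin 2 → ℂ) → ℝ → ℂ :=
  ![fun U _ => cmeTerm κ Γ l (U 0) (U 1), fun U _ => cmeTerm κ Γ l (U 1) (U 0)]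

/-- A Lipschitz constant of the truncated zeroth order part. -/
def cmeLip (κ Γ l : ℝ) : ℝ≥0 := (|κ| + 10 * |Γ| * l ^ 2).toNNReal

theorem coe_cmeLip (κ Γ l : ℝ) : (cmeLip κ Γ l : ℝ) = |κ| + 10 * |Γ| * l ^ 2 :=
  Real.coe_toNNReal _ (by positivity)

theorem isTameDensity_cmeDensity (κ Γ : ℝ) {l : ℝ} (hl : 0 ≤ l) :
    IsTameDensity (cmeDensity κ Γ l) (cmeLip κ Γ l) 0 where
  lip i U V z := by
    rw [Fin.sum_univ_two, coe_cmeLip]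
    fin_cases i
    · exact norm_cmeTerm_sub_le κ Γ hl _ _ _ _
    · rw [add_comm ‖U 0 - V 0‖]
      exact norm_cmeTerm_sub_le κ Γ hl _ _ _ _
  trans i U z h := by
    fin_cases i <;> simp [cmeDensity]
  zero i z := by
    fin_cases i <;> simp [cmeDensity, cmeTerm]

/-- The first order part of the coupled mode equations. -/
def cmeGenerator (v : ℝ) : Vec (Fin 2) ℂ →L[ℝ] Vec (Fin 2) ℂ :=
  vecCLM fun j => (![-v, v] : Fin 2 → ℝ) j • PiLp.proj 2 _ j

theorem isPropagator_cmeGenerator (v : ℝ) :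
    IsPropagator (diagShift (F := ℂ) ![-v, v]) (cmeGenerator v) :=
  isPropagator_diagShift _ fun _ _ => rfl

/-- The set of pairs `(y, s)` such that all components of `y` are bounded by `s`. -/
def boundedCone (ι : Type*) [Fintype ι] (F : Type*) [NormedAddCommGroup F] : Set (Vec ι F × ℝ) :=
  {p | ∀ j, ∀ᵐ z, ‖p.1 j z‖ ≤ p.2}

/-- L² convergence gives almost everywhere convergence along a subsequence, which preserves the
pointwise bound. -/
theorem isClosed_boundedCone (ι : Type*) [Fintype ι] (F : Type*) [NormedAddCommGroup F] :
    IsClosed (boundedCone ι F) := by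
  refine IsSeqClosed.isClosed fun x p hx hp j => ?_
  have h1 : Tendsto (fun n => (x n).1 j) atTop (𝓝 (p.1 j)) :=
    ((PiLp.continuous_apply 2 _ j).tendsto _).comp ((continuous_fst.tendsto p).comp hp)
  have h2 : Tendsto (fun n => (x n).2) atTop (𝓝 p.2) := (continuous_snd.tendsto p).comp hp
  obtain ⟨ns, hns, hae⟩ := (tendstoInMeasure_of_tendsto_Lp h1).exists_seq_tendsto_ae
  filter_upwards [hae, ae_all_iff.2 fun n => hx n j] with z hz hz'
  exact le_of_tendsto_of_tendsto' hz.norm (h2.comp hns.tendsto_atTop) fun n => hz' (ns n)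

theorem diagShift_mem_boundedCone {ι F : Type*} [Fintype ι] [NormedAddCommGroup F]
    [InnerProductSpace ℝ F] {y : Vec ι F} {s : ℝ} (h : (y, s) ∈ boundedCone ι F) (c : ι → ℝ)
    (t : ℝ) : (diagShift c t y, s) ∈ boundedCone ι F := fun j => by
  filter_upwards [coeFn_shift (c j * t) (y j), ae_comp_add (h j) (c j * t)] with z h1 h2
  rw [diagShift_apply, h1]
  exact h2

theorem euler_step_mem_boundedCone {κ Γ l s h : ℝ} (hl : 0 ≤ l) {y : Vec (Fin 2) ℂ}
    (hy : (y, s) ∈ boundedCone (Fin 2) ℂ) (hh : 0 < h) (hh' : h * (|Γ| * l ^ 2) ^ 2 ≤ 1) :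
    (y + h • (isTameDensity_cmeDensity κ Γ hl).superposition y, s + h * ((|κ| + 1) * s))
      ∈ boundedCone (Fin 2) ℂ := by
  have key : ∀ j, ∀ᵐ z, (y + h • (isTameDensity_cmeDensity κ Γ hl).superposition y) j z
      = y j z + h • cmeDensity κ Γ l j (fun i => y i z) z := fun j => by
    filter_upwards [Lp.coeFn_add (y j)
      ((h • (isTameDensity_cmeDensity κ Γ hl).superposition y) j),
      Lp.coeFn_smul h ((isTameDensity_cmeDensity κ Γ hl).superposition y j),
      (isTameDensity_cmeDensity κ Γ hl).coeFn_superposition y j] with z h1 h2 h3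
    rw [PiLp.add_apply, h1, Pi.add_apply, PiLp.smul_apply, h2, Pi.smul_apply, h3]
  intro j
  filter_upwards [key j, hy 0, hy 1] with z h1 h2 h3
  refine (congrArg norm h1).trans_le ?_
  fin_cases j
  · exact norm_add_smul_cmeTerm_le h2 h3 hh hh'
  · exact norm_add_smul_cmeTerm_le h3 h2 hh hh'

/-- A priori bound in `L^∞` for the truncated coupled mode equations. -/
theorem IsH1Solution.ae_norm_le_exp {v κ Γ l m : ℝ} {hl : 0 ≤ l} {u₀ : NLCMEState}
    {u : ℝ → NLCMEState}
    (hu : IsH1Solution (cmeGenerator v) (isTameDensity_cmeDensity κ Γ hl).superposition ⊤ u₀ u)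
    (hm : ∀ j, ∀ᵐ z, ‖valueVec u₀ j z‖ ≤ m) {t : ℝ} (ht : 0 ≤ t) (j : Fin 2) :
    ∀ᵐ z, ‖valueVec (u t) j z‖ ≤ m * Real.exp ((|κ| + 1) * t) := by
  obtain ⟨N, hN⟩ : ∃ N, N = (isTameDensity_cmeDensity κ Γ hl).superposition := ⟨_, rfl⟩
  have hNl := (isTameDensity_cmeDensity κ Γ hl).isTameNonlinearity.lipschitz
  rw [← hN] at hu hNl
  obtain ⟨S, hSdef⟩ : ∃ S, S = diagShift (F := ℂ) ![-v, v] := ⟨_, rfl⟩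
  have hS : IsPropagator S (cmeGenerator v) := hSdef ▸ isPropagator_cmeGenerator v
  obtain ⟨lam, hlam⟩ : ∃ lam, lam = |κ| + 1 := ⟨_, rfl⟩
  rw [← hlam]
  -- The bound s is carried as an extra unknown with s' = lam s, which turns a growing bound into
  -- invariance of one fixed closed set.
  let E : ℝ → Vec (Fin 2) ℂ × ℝ → Vec (Fin 2) ℂ × ℝ := fun t p =>
    (S (-t) (N (S t p.1)), lam * p.2)
  obtain ⟨K, hE⟩ : ∃ K, ∀ t, LipschitzWith K (E t) := ⟨_, fun t =>
    ((hS.lipschitzWith_conj hNl t).comp LipschitzWith.prod_fst).prodMk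
      ((lipschitzWith_smul lam).comp LipschitzWith.prod_snd)⟩
  have hsub : Ici (0 : ℝ) ⊆ timeInterval ⊤ := timeInterval_top.symm.subset
  have huc : ContinuousOn (fun t => valueVec (u t)) (Ici 0) :=
    continuous_valueVec.comp_continuousOn (hu.continuousOn.mono hsub)
  have hexp : ∀ t, HasDerivAt (fun t => m * Real.exp (lam * t))
      (lam * (m * Real.exp (lam * t))) t := fun t => by
    have := (((hasDerivAt_id t).const_mul lam).exp).const_mul m
    convert! this using 1
    simp only [id, mul_one]
    ring
  -- The step h₀ ensures h(|Γ|l²)² ≤ 1; the + 1 in it avoids a vanishing denominator.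
  have key := ode_mem_of_euler_step_mem (F := E) (B := boundedCone (Fin 2) ℂ) (T := t)
    (h₀ := ((|Γ| * l ^ 2) ^ 2 + 1)⁻¹)
    (y := fun t => (S (-t) (valueVec (u t)), m * Real.exp (lam * t)))
    hE (isClosed_boundedCone _ _) (by positivity) ?_ ?_ ?_ ?_ t ⟨ht, le_rfl⟩
  · have := diagShift_mem_boundedCone key ![-v, v] t
    rw [← hSdef, hS.apply_neg] at this
    exact this j
  · intro τ _ q hq h hh hh'
    have h1 : h * (|Γ| * l ^ 2) ^ 2 ≤ 1 := by
      have h2 : 0 < (|Γ| * l ^ 2) ^ 2 + 1 := by positivity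
      have h3 := mul_le_mul_of_nonneg_right hh' h2.le
      rw [inv_mul_cancel₀ h2.ne'] at h3
      linarith
    -- The Euler step is taken in the original frame, between S τ and S (-τ); translations preserve
    -- the cone.
    have h2 := euler_step_mem_boundedCone (κ := κ) hl
      (diagShift_mem_boundedCone (y := q.1) (s := q.2) hq ![-v, v] τ) hh h1
    have h3 := diagShift_mem_boundedCone h2 ![-v, v] (-τ)
    rw [← hSdef, ← hN, ← hlam, map_add, hS.neg_apply, map_smul] at h3
    exact h3
  · have h1 : ContinuousOn (fun τ => S (-τ) (valueVec (u τ))) (Icc 0 t) :=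
      hS.continuous_uncurry.comp_continuousOn
        (continuous_neg.continuousOn.prodMk (huc.mono Icc_subset_Ici_self))
    exact h1.prodMk (by fun_prop)
  · intro τ hτ
    have hτ' : τ ∈ timeInterval ⊤ := hsub hτ.1
    have h1 := hS.hasDerivWithinAt_conj (hasWeakDerivs_valueVec (u τ))
      ((hu.eq τ hτ').mono_of_mem_nhdsWithin (timeInterval_mem_nhdsWithin_Ici hτ'))
    have h2 := h1.prodMk (hexp τ).hasDerivWithinAt
    have e : E τ (S (-τ) (valueVec (u τ)), m * Real.exp (lam * τ))
        = (S (-τ) (N (valueVec (u τ))), lam * (m * Real.exp (lam * τ))) := by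
      simp only [E, hS.apply_neg]
    rw [e]
    exact h2
  · intro i
    simp only [neg_zero, hS.zero, mul_zero, Real.exp_zero, mul_one, hu.initial]
    exact hm i

end NLCME

/-! ### Coupled mode equations: removing the truncation and globalizing. -/

section NLCME

theorem ae_norm_valueVec_le (u : NLCMEState) (j : Fin 2) :
    ∀ᵐ z, ‖valueVec u j z‖ ≤ 2 * ‖u‖ := by
  filter_upwards [(hasWeakDerivs_valueVec u j).ae_norm_le] with z hz
  refine hz.trans ?_
  have h : ‖u‖ ^ 2 = ‖valueVec u‖ ^ 2 + ‖derivVec u‖ ^ 2 := by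
    rw [norm_vecH1]
    exact WithLp.prod_norm_sq_eq_of_L2 _
  have h1 : ‖valueVec u‖ ≤ ‖u‖ := norm_valueVec_le u
  have h2 : ‖derivVec u‖ ≤ ‖u‖ :=
    abs_le_of_sq_le_sq' (by nlinarith [sq_nonneg ‖valueVec u‖]) (norm_nonneg _) |>.2
  have h3 : ‖valueVec u j‖ ≤ ‖valueVec u‖ := PiLp.norm_apply_le (valueVec u) j
  have h4 : ‖derivVec u j‖ ≤ ‖derivVec u‖ := PiLp.norm_apply_le (derivVec u) j
  linarith

theorem IsNLCMESolution.mono {v κ Γ : ℝ} {T T' : EReal} {u₀ : NLCMEState} {u : ℝ → NLCMEState}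
    (h : IsNLCMESolution v κ Γ T u₀ u) (hT : T' ≤ T) : IsNLCMESolution v κ Γ T' u₀ u where
  continuousOn := h.continuousOn.mono (timeInterval_mono hT)
  initial := h.initial
  eq_plus t ht := by
    obtain ⟨D, hD, hz⟩ := h.eq_plus t (timeInterval_mono hT ht)
    exact ⟨D, HasDerivWithinAt.mono hD (timeInterval_mono hT), hz⟩
  eq_minus t ht := by
    obtain ⟨D, hD, hz⟩ := h.eq_minus t (timeInterval_mono hT ht)
    exact ⟨D, HasDerivWithinAt.mono hD (timeInterval_mono hT), hz⟩

theorem cme_eq_zero_iff {κ Γ l M c : ℝ} {D d x y : ℂ} (hM : 3 * M ^ 2 ≤ l ^ 2)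
    (hx : ‖x‖ ≤ M) (hy : ‖y‖ ≤ M) :
    Complex.I * (D - c * d) + κ * y + Γ * ((‖x‖ ^ 2 + 2 * ‖y‖ ^ 2 : ℝ) : ℂ) * x = 0 ↔
      D = c * d + cmeTerm κ Γ l x y := by
  rw [cmeTerm, truncCoeff_eq hM hx hy]
  have hI : Complex.I * Complex.I = -1 := Complex.I_mul_I
  constructor
  · intro h
    linear_combination (-Complex.I) * h + (D - c * d) * hI
  · intro h
    rw [h]
    linear_combination (κ * y + Γ * ((‖x‖ ^ 2 + 2 * ‖y‖ ^ 2 : ℝ) : ℂ) * x) * hI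

/-- Where both components are bounded by M the cutoff is inactive, since |x|² + 2|y|² ≤ 3M² ≤ l². -/
theorem isNLCMESolution_iff {v κ Γ l M : ℝ} {hl : 0 ≤ l} {T : EReal} {u₀ : NLCMEState}
    {u : ℝ → NLCMEState} (hM : 3 * M ^ 2 ≤ l ^ 2)
    (hb : ∀ t ∈ timeInterval T, ∀ j, ∀ᵐ z, ‖valueVec (u t) j z‖ ≤ M) :
    IsNLCMESolution v κ Γ T u₀ u ↔
      IsH1Solution (cmeGenerator v) (isTameDensity_cmeDensity κ Γ hl).superposition T u₀ u := by
  obtain ⟨W, hW⟩ : ∃ W : NLCMEState → Vec (Fin 2) ℂ, W = fun w => cmeGenerator v (derivVec w)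
    + (isTameDensity_cmeDensity κ Γ hl).superposition (valueVec w) := ⟨_, rfl⟩
  have hW0 : ∀ w, ∀ᵐ z, W w 0 z = (-v : ℝ) * dz (w 0) z + cmeTerm κ Γ l (toL2 (w 0) z)
      (toL2 (w 1) z) := fun w => by
    filter_upwards [Lp.coeFn_add (cmeGenerator v (derivVec w) 0)
      ((isTameDensity_cmeDensity κ Γ hl).superposition (valueVec w) 0),
      Lp.coeFn_smul (-v) (dz (w 0)),
      (isTameDensity_cmeDensity κ Γ hl).coeFn_superposition (valueVec w) 0] with z h1 h2 h3
    rw [hW]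
    refine h1.trans ?_
    rw [Pi.add_apply, h3]
    exact congrArg₂ _ h2 rfl
  have hW1 : ∀ w, ∀ᵐ z, W w 1 z = (v : ℝ) * dz (w 1) z + cmeTerm κ Γ l (toL2 (w 1) z)
      (toL2 (w 0) z) := fun w => by
    filter_upwards [Lp.coeFn_add (cmeGenerator v (derivVec w) 1)
      ((isTameDensity_cmeDensity κ Γ hl).superposition (valueVec w) 1),
      Lp.coeFn_smul v (dz (w 1)),
      (isTameDensity_cmeDensity κ Γ hl).coeFn_superposition (valueVec w) 1] with z h1 h2 h3
    rw [hW]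
    refine h1.trans ?_
    rw [Pi.add_apply, h3]
    exact congrArg₂ _ h2 rfl
  have k0 : ∀ t ∈ timeInterval T, ∀ D : L2 ℂ, (∀ᵐ z, Complex.I * (D z + v * dz (u t 0) z)
      + κ * toL2 (u t 1) z + Γ * ((‖toL2 (u t 0) z‖ ^ 2 + 2 * ‖toL2 (u t 1) z‖ ^ 2 : ℝ) : ℂ)
        * toL2 (u t 0) z = 0) ↔ D = W (u t) 0 := fun t ht D => by
    rw [Lp.ext_iff]
    refine eventually_congr ?_
    filter_upwards [hW0 (u t), hb t ht 0, hb t ht 1] with z h1 h2 h3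
    rw [valueVec_apply] at h2 h3
    rw [h1, ← cme_eq_zero_iff hM h2 h3, Complex.ofReal_neg, neg_mul, sub_neg_eq_add]
  have k1 : ∀ t ∈ timeInterval T, ∀ D : L2 ℂ, (∀ᵐ z, Complex.I * (D z - v * dz (u t 1) z)
      + κ * toL2 (u t 0) z + Γ * ((‖toL2 (u t 1) z‖ ^ 2 + 2 * ‖toL2 (u t 0) z‖ ^ 2 : ℝ) : ℂ)
        * toL2 (u t 1) z = 0) ↔ D = W (u t) 1 := fun t ht D => by
    rw [Lp.ext_iff]
    refine eventually_congr ?_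
    filter_upwards [hW1 (u t), hb t ht 0, hb t ht 1] with z h1 h2 h3
    rw [valueVec_apply] at h2 h3
    rw [h1, ← cme_eq_zero_iff hM h3 h2]
  constructor
  · intro h
    refine ⟨h.continuousOn, h.initial, fun t ht => ?_⟩
    have : HasDerivWithinAt (fun s => valueVec (u s)) (W (u t)) (timeInterval T) t := by
      refine hasDerivWithinAt_vec.2 fun j => ?_
      fin_cases j
      · obtain ⟨D, hD, hz⟩ := h.eq_plus t ht
        exact (k0 t ht D).1 hz ▸ hD
      · obtain ⟨D, hD, hz⟩ := h.eq_minus t ht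
        exact (k1 t ht D).1 hz ▸ hD
    rw [hW] at this
    exact this
  · intro h
    have h' : ∀ t ∈ timeInterval T,
        HasDerivWithinAt (fun s => valueVec (u s)) (W (u t)) (timeInterval T) t := by
      rw [hW]
      exact h.eq
    exact ⟨h.continuousOn, h.initial,
      fun t ht => ⟨W (u t) 0, hasDerivWithinAt_vec.1 (h' t ht) 0, (k0 t ht _).2 rfl⟩,
      fun t ht => ⟨W (u t) 1, hasDerivWithinAt_vec.1 (h' t ht) 1, (k1 t ht _).2 rfl⟩⟩

/-- On a compact subinterval both curves are bounded in H¹, hence in L^∞, so one cutoff level above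
both makes them solutions of the same Lipschitz problem. -/
theorem IsNLCMESolution.eqOn {v κ Γ : ℝ} {T : EReal} {u₀ : NLCMEState} {u w : ℝ → NLCMEState}
    (hu : IsNLCMESolution v κ Γ T u₀ u) (hw : IsNLCMESolution v κ Γ T u₀ w) :
    EqOn u w (timeInterval T) := by
  intro t ht
  obtain ⟨b, htb, hbT⟩ := EReal.lt_iff_exists_real_btwn.1 ht.2
  have hsub := Icc_subset_timeInterval hbT
  obtain ⟨M₁, hM₁⟩ := isCompact_Icc.exists_bound_of_continuousOn (hu.continuousOn.mono hsub)
  obtain ⟨M₂, hM₂⟩ := isCompact_Icc.exists_bound_of_continuousOn (hw.continuousOn.mono hsub)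
  obtain ⟨M, hM⟩ : ∃ M, M = 2 * max M₁ M₂ := ⟨_, rfl⟩
  have hl : 0 ≤ 2 * |M| := by positivity
  have hMl : 3 * M ^ 2 ≤ (2 * |M|) ^ 2 := by
    rw [mul_pow, sq_abs]; nlinarith [sq_nonneg M]
  have hmem : ∀ s ∈ timeInterval (b : EReal), s ∈ Icc 0 b := fun s hs =>
    ⟨hs.1, (EReal.coe_lt_coe_iff.1 hs.2).le⟩
  have hu' := (isNLCMESolution_iff (hl := hl) hMl fun s hs j => by
    filter_upwards [ae_norm_valueVec_le (u s) j] with z hz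
    refine hz.trans ?_
    have := (hM₁ s (hmem s hs)).trans (le_max_left M₁ M₂)
    linarith).1 (hu.mono hbT.le)
  have hw' := (isNLCMESolution_iff (hl := hl) hMl fun s hs j => by
    filter_upwards [ae_norm_valueVec_le (w s) j] with z hz
    refine hz.trans ?_
    have := (hM₂ s (hmem s hs)).trans (le_max_right M₁ M₂)
    linarith).1 (hw.mono hbT.le)
  exact (isPropagator_cmeGenerator v).eqOn_of_isH1Solution
    (isTameDensity_cmeDensity κ Γ hl).isTameNonlinearity.lipschitz hu' hw' ⟨ht.1, htb⟩

/-- Existence on bounded time intervals, with a bound whose rate depends on the interval. -/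
theorem exists_isNLCMESolution_of_norm_le (v κ Γ : ℝ) {m : ℝ} (u₀ : NLCMEState)
    (hm : 2 * ‖u₀‖ ≤ m) (b : ℝ) :
    ∃ u, IsNLCMESolution v κ Γ b u₀ u ∧ ∀ t ∈ timeInterval b, ‖u t‖ ≤
      ‖u₀‖ * Real.exp (8 * (|κ| + 10 * |Γ| * (2 * (m * Real.exp ((|κ| + 1) * b))) ^ 2) * t) := by
  have hm0 : 0 ≤ m := (by positivity : 0 ≤ 2 * ‖u₀‖).trans hm
  -- M is the a priori sup bound at time b. It does not depend on the cutoff level, so choosing l =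
  -- 2M afterwards is not circular.
  obtain ⟨M, hM⟩ : ∃ M, M = m * Real.exp ((|κ| + 1) * b) := ⟨_, rfl⟩
  have hl : 0 ≤ 2 * M := by rw [hM]; positivity
  have hG := isTameDensity_cmeDensity κ Γ hl
  obtain ⟨u, hu, hbd⟩ :=
    (isPropagator_cmeGenerator v).exists_isH1Solution hG.isTameNonlinearity u₀
  refine ⟨u, (isNLCMESolution_iff (M := M) (hl := hl) (by nlinarith [sq_nonneg M])
    fun t ht j => ?_).2 (hu.mono le_top), fun t ht => ?_⟩
  · have htb : t ≤ b := (EReal.coe_lt_coe_iff.1 ht.2).le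
    filter_upwards [hu.ae_norm_le_exp (hl := hl) (fun j => (ae_norm_valueVec_le u₀ j).mono fun z hz =>
      hz.trans hm) ht.1 j] with z hz
    refine hz.trans ?_
    rw [hM]
    gcongr
  -- The factor 8 is card² · 2 with two components, the density being independent of z.
  · refine (hbd t ht.1).trans (le_of_eq ?_)
    rw [← hM]
    congr 3
    push_cast
    rw [coe_cmeLip, Fintype.card_fin]
    norm_num
    ring

/-- Uniqueness makes the w n agree on common intervals. As [0, ⌊t⌋ + 1) is a neighbourhood of t in
[0, ∞), continuity and the equations at t are inherited from the single solution w ⌊t⌋. -/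
theorem exists_nlcme_of_forall_nat {v κ Γ : ℝ} {u₀ : NLCMEState} {w : ℕ → ℝ → NLCMEState}
    (hw : ∀ n : ℕ, IsNLCMESolution v κ Γ ((n + 1 : ℝ) : EReal) u₀ (w n)) :
    IsNLCMESolution v κ Γ ⊤ u₀ fun t => w ⌊t⌋₊ t := by
  have heq : ∀ n : ℕ, EqOn (fun t => w ⌊t⌋₊ t) (w n) (timeInterval ((n + 1 : ℝ) : EReal)) := by
    intro n t ht
    have h1 : t < n + 1 := EReal.coe_lt_coe_iff.1 ht.2
    have h2 : ⌊t⌋₊ ≤ n := Nat.lt_succ_iff.1 ((Nat.floor_lt ht.1).2 (by push_cast; exact h1))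
    refine (hw ⌊t⌋₊).eqOn ((hw n).mono (EReal.coe_le_coe_iff.2 ?_))
      ⟨ht.1, EReal.coe_lt_coe_iff.2 (Nat.lt_floor_add_one t)⟩
    have : (⌊t⌋₊ : ℝ) ≤ n := by exact_mod_cast h2
    linarith
  have hmem : ∀ t : ℝ, 0 ≤ t → t ∈ timeInterval ((⌊t⌋₊ + 1 : ℝ) : EReal) := fun t ht =>
    ⟨ht, EReal.coe_lt_coe_iff.2 (Nat.lt_floor_add_one t)⟩
  have hnhds : ∀ t : ℝ, 0 ≤ t →
      timeInterval ((⌊t⌋₊ + 1 : ℝ) : EReal) ∈ 𝓝[timeInterval ⊤] t := fun t ht => by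
    rw [timeInterval_top, mem_nhdsWithin]
    exact ⟨Iio (⌊t⌋₊ + 1), isOpen_Iio, Nat.lt_floor_add_one t, fun s hs =>
      ⟨hs.2, EReal.coe_lt_coe_iff.2 hs.1⟩⟩
  have hderiv : ∀ (t : ℝ) (_ : 0 ≤ t) (j : Fin 2) (D : L2 ℂ),
      HasTimeDeriv ((⌊t⌋₊ + 1 : ℝ) : EReal) (fun s => w ⌊t⌋₊ s j) D t →
      HasTimeDeriv ⊤ (fun s => w ⌊s⌋₊ s j) D t := fun t ht j D hD =>
    (HasDerivWithinAt.congr hD (fun s hs => congrArg (fun x : NLCMEState => toL2 (x j))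
      (heq _ hs)) rfl).mono_of_mem_nhdsWithin (hnhds t ht)
  refine ⟨fun t ht => ?_, ?_, fun t ht => ?_, fun t ht => ?_⟩
  · exact (((hw _).continuousOn t (hmem t ht.1)).congr (heq _) rfl).mono_of_mem_nhdsWithin
      (hnhds t ht.1)
  · simpa using (hw 0).initial
  · obtain ⟨D, hD, hz⟩ := (hw _).eq_plus t (hmem t ht.1)
    exact ⟨D, hderiv t ht.1 0 D hD, hz⟩
  · obtain ⟨D, hD, hz⟩ := (hw _).eq_minus t (hmem t ht.1)
    exact ⟨D, hderiv t ht.1 1 D hD, hz⟩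

/-- Rests on e^x - 1 ≥ (x/2)e^{x/2} with x = ct; the choice of c ensures a ≤ c/2 and D ≤ c²/2. -/
theorem mul_exp_mul_le_double_exp {a D t : ℝ} (ha : 0 ≤ a) (hD : 0 ≤ D) (ht : 0 ≤ t) :
    D * Real.exp (a * t) * t ≤ (2 * a + D + 1) * (Real.exp ((2 * a + D + 1) * t) - 1) := by
  set c := 2 * a + D + 1 with hc
  have h1 : Real.exp (c * t) = Real.exp (c * t / 2) * Real.exp (c * t / 2) := by
    rw [← Real.exp_add]; ring_nf
  have h2 : c * t / 2 + 1 ≤ Real.exp (c * t / 2) := Real.add_one_le_exp _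
  have h3 : 1 ≤ Real.exp (c * t / 2) := Real.one_le_exp (by positivity)
  have h4 : Real.exp (a * t) ≤ Real.exp (c * t / 2) := Real.exp_le_exp.2 (by nlinarith)
  have h5 : Real.exp (c * t / 2) * (c * t / 2) ≤ Real.exp (c * t) - 1 := by
    rw [h1]; nlinarith
  have hc0 : 0 ≤ c := by positivity
  have h6 : D ≤ c * c / 2 := by nlinarith [sq_nonneg (D - 1), mul_nonneg ha hD, sq_nonneg a]
  calc D * Real.exp (a * t) * t ≤ (c * c / 2) * Real.exp (c * t / 2) * t := by gcongr
    _ = c * (Real.exp (c * t / 2) * (c * t / 2)) := by ring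
    _ ≤ c * (Real.exp (c * t) - 1) := by gcongr

theorem nlcme_global_wellposedness (v κ Γ R : ℝ) :
    ∃ c : ℝ, 0 < c ∧ ∀ u₀ : NLCMEState, ‖u₀‖ ≤ R → nlcmeTmax v κ Γ u₀ = ⊤ ∧
      ∃ u : ℝ → NLCMEState, IsNLCMESolution v κ Γ ⊤ u₀ u ∧
        (∀ (T : EReal) (w : ℝ → NLCMEState), IsNLCMESolution v κ Γ T u₀ w →
          EqOn w u (timeInterval T)) ∧
        ∀ t : ℝ, 0 ≤ t → ‖u t‖ ≤ ‖u₀‖ * Real.exp (c * (Real.exp (c * t) - 1)) := by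
  -- The cutoff level enters squared, so a is twice the sup norm rate. In D, the factor e^a pays for
  -- rounding t up to ⌊t⌋ + 1, and 16R² = (2 · 2R)², where 2R bounds the sup norm of the data.
  obtain ⟨a, ha⟩ : ∃ a, a = 2 * (|κ| + 1) := ⟨_, rfl⟩
  have ha0 : 0 ≤ a := by rw [ha]; positivity
  obtain ⟨D, hD⟩ : ∃ D, D = 8 * (|κ| + 10 * |Γ| * (16 * R ^ 2 * Real.exp a)) := ⟨_, rfl⟩
  have hD0 : 0 ≤ D := by rw [hD]; positivity
  refine ⟨2 * a + D + 1, by positivity, fun u₀ hR => ?_⟩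
  have hR0 : 0 ≤ R := (norm_nonneg _).trans hR
  have hex : ∀ n : ℕ, ∃ u, IsNLCMESolution v κ Γ ((n + 1 : ℝ) : EReal) u₀ u ∧
      ∀ t ∈ timeInterval ((n + 1 : ℝ) : EReal), ‖u t‖ ≤ ‖u₀‖ * Real.exp
        (8 * (|κ| + 10 * |Γ| * (2 * (2 * R * Real.exp ((|κ| + 1) * (n + 1)))) ^ 2) * t) := fun n =>
    exists_isNLCMESolution_of_norm_le v κ Γ u₀ (by linarith) (n + 1)
  choose w hw hwb using hex
  have hu := exists_nlcme_of_forall_nat hw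
  refine ⟨top_le_iff.1 (le_sSup ⟨le_top, _, hu⟩), _, hu, fun T x hx => hx.eqOn (hu.mono le_top),
    fun t ht => ?_⟩
  refine (hwb ⌊t⌋₊ t ⟨ht, EReal.coe_lt_coe_iff.2 (Nat.lt_floor_add_one t)⟩).trans ?_
  refine mul_le_mul_of_nonneg_left (Real.exp_le_exp.2 ?_) (norm_nonneg _)
  refine le_trans ?_ (mul_exp_mul_le_double_exp ha0 hD0 ht)
  have h1 : Real.exp ((|κ| + 1) * (⌊t⌋₊ + 1)) ^ 2 ≤ Real.exp a * Real.exp (a * t) := by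
    rw [← Real.exp_nat_mul, ← Real.exp_add]
    refine Real.exp_le_exp.2 ?_
    have := Nat.floor_le ht
    rw [ha]
    push_cast
    nlinarith [abs_nonneg κ]
  have h2 : 1 ≤ Real.exp (a * t) := Real.one_le_exp (by positivity)
  refine mul_le_mul_of_nonneg_right ?_ ht
  calc 8 * (|κ| + 10 * |Γ| * (2 * (2 * R * Real.exp ((|κ| + 1) * (⌊t⌋₊ + 1)))) ^ 2)
      = 8 * (|κ| + 10 * |Γ| * (16 * R ^ 2 * Real.exp ((|κ| + 1) * (⌊t⌋₊ + 1)) ^ 2)) := by ring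
    _ ≤ 8 * (|κ| * Real.exp (a * t)
          + 10 * |Γ| * (16 * R ^ 2 * (Real.exp a * Real.exp (a * t)))) := by
        gcongr
        exact le_mul_of_one_le_right (abs_nonneg κ) h2
    _ = D * Real.exp (a * t) := by rw [hD]; ring

end NLCME

end GapSoliton

end

theorem mainTheorem3 :
    (∀ (ω₀ n ε ν k_B : ℝ) (g : ℝ → ℝ → ℝ), GapSoliton.HypothesisN1 g →
      ∃ C : ℝ, 0 < C ∧ ∀ u₀ : GapSoliton.AMLEState,
        GapSoliton.amleTmax ω₀ n ε ν k_B g u₀ = ⊤ ∧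
        ∃ u : ℝ → GapSoliton.AMLEState,
          GapSoliton.IsAMLESolution ω₀ n ε ν k_B g ⊤ u₀ u ∧
          (∀ (T : EReal) (v : ℝ → GapSoliton.AMLEState),
            GapSoliton.IsAMLESolution ω₀ n ε ν k_B g T u₀ v →
              Set.EqOn v u (GapSoliton.timeInterval T)) ∧
          ∀ t : ℝ, 0 ≤ t → ‖u t‖ ≤ ‖u₀‖ * Real.exp (C * t)) ∧
    (∀ (v_g κ Γ R : ℝ), ∃ c : ℝ, 0 < c ∧ ∀ u₀ : GapSoliton.NLCMEState, ‖u₀‖ ≤ R →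
        GapSoliton.nlcmeTmax v_g κ Γ u₀ = ⊤ ∧
        ∃ u : ℝ → GapSoliton.NLCMEState,
          GapSoliton.IsNLCMESolution v_g κ Γ ⊤ u₀ u ∧
          (∀ (T : EReal) (v : ℝ → GapSoliton.NLCMEState),
            GapSoliton.IsNLCMESolution v_g κ Γ T u₀ v →
              Set.EqOn v u (GapSoliton.timeInterval T)) ∧
          ∀ t : ℝ, 0 ≤ t → ‖u t‖ ≤ ‖u₀‖ * Real.exp (c * (Real.exp (c * t) - 1))) := by
  exact ⟨GapSoliton.amle_global_wellposedness, GapSoliton.nlcme_global_wellposedness⟩
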